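/- **Theorem.** Let $M$ be a connected three-dimensional Lie group that is not unimodular (i.e. $\operatorname{trace}(\operatorname{ad} m)\neq 0$ for some $m$ in its Lie algebra), and let $(M,\Delta,\mathbf g)$ be a left-invariant contact sub-Riemannian structure on $M$: $\Delta$ is a left-invariant contact distribution of planes and $\mathbf g$ a left-invariant inner product on $\Delta$. A left-invariant frame $f_0,f_1,f_2$ is called *adapted* if $f_1,f_2$ is an orthonormal frame of $\Delta$ and $f_0$ is the Reeb field of the contact form $\omega$ with $\ker\omega=\Delta$ and $d\omega(f_1,f_2)=1$ (that is, $\omega(f_0)=1$, $\iota_{f_0}d\omega=0$). Write $$[f_2,f_1]=f_0+c_{12}^1f_1+c_{12}^2f_2,\qquad [f_1,f_0]=c_{10}^1f_1+c_{10}^2f_2,\qquad [f_2,f_0]=c_{20}^1f_1+c_{20}^2f_2,$$ and let $$\chi=\sqrt{-c_{10}^1c_{20}^2+\tfrac14\left(c_{10}^2+c_{20}^1\right)^2},$$ which does not depend on the adapted frame. Assume $\chi\neq0$. Then there is a *canonical frame*, i.e. an adapted frame with $c_{10}^1=c_{20}^2=0$. For every canonical frame $f_0,f_1,f_2$, the structure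 $(M,\Delta,\mathbf g)$ is locally conformally flat if and only if the frame satisfies one of the systems $$\text{i)}\ \begin{cases}[f_2,f_1]=f_0+c_{12}^2f_2,\\ [f_1,f_0]=\tfrac29(c_{12}^2)^2f_2,\\ [f_2,f_0]=0,\end{cases}\qquad \text{ii)}\ \begin{cases}[f_2,f_1]=f_0+c_{12}^1f_1,\\ [f_2,f_0]=-\tfrac29(c_{12}^1)^2f_1,\\ [f_1,f_0]=0.\end{cases}$$ Here, a smooth function $\varphi$ on an open set $U\subseteq M$ is *admissible* if $(U,\Delta,e^{2\varphi}\mathbf g)$ is locally isometric to the Heisenberg group $\mathbb H_3$ ($\mathbb R^3$ with the orthonormal frame $\partial_y+\frac x2\partial_z$, $\partial_x-\frac y2\partial_z$), and $(M,\Delta,\mathbf g)$ is *locally conformally flat* if every point of $M$ has an open neighbourhood with an admissible function. Moreover, in case i) every point of $M$ has an open neighbourhood $U$ with a smooth $\varphi:U\to\mathbb R$ satisfying $$f_1(\varphi)=-\tfrac{c_{12}^2}{3},\qquad f_2(\varphi)=0,$$ and every smooth solution $\varphi$ of these equations on an open set $U\subseteq M$ is admissible. In case ii) the same holds with the equations $$f_2(\varphi)=\tfrac{c_{12}^1}{3},\qquad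 f_1(\varphi)=0.$$ -/

import Mathlib

open scoped Manifold ContDiff

noncomputable section

/-- The model space of three dimensional manifolds. -/
abbrev E3 : Type := EuclideanSpace ℝ (Fin 3)

section Fields

variable {M : Type*} [TopologicalSpace M] [ChartedSpace E3 M] [IsManifold (𝓡 3) ∞ M]

/-- A vector field (not assumed to be smooth). -/
abbrev VField (M : Type*) [TopologicalSpace M] [ChartedSpace E3 M] : Type _ :=
  (q : M) → TangentSpace (𝓡 3) q

/-- A differential one-form (not assumed to be smooth). -/
abbrev OneForm (M : Type*) [TopologicalSpace M] [ChartedSpace E3 M] : Type _ :=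
  (q : M) → (TangentSpace (𝓡 3) q →L[ℝ] ℝ)

/-- The vector field `X` is smooth on `U`. -/
def SmoothFieldOn (X : VField M) (U : Set M) : Prop :=
  ContMDiffOn (𝓡 3) ((𝓡 3).tangent) ∞ (fun q => (⟨q, X q⟩ : TangentBundle (𝓡 3) M)) U

/-- The function `φ` is smooth on `U`. -/
def SmoothFunOn (φ : M → ℝ) (U : Set M) : Prop :=
  ContMDiffOn (𝓡 3) 𝓘(ℝ, ℝ) ∞ φ U

/-- The derivative `X(φ)` of the function `φ` along the vector field `X`, at `q`. -/
def fieldDeriv (X : VField M) (φ : M → ℝ) (q : M) : ℝ :=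
  mfderiv (𝓡 3) 𝓘(ℝ, ℝ) φ q (X q)

/-- The one-form `α` is smooth on `U`: its values on smooth local vector fields are smooth. -/
def SmoothFormOn (α : OneForm M) (U : Set M) : Prop :=
  ∀ V : Set M, IsOpen V → V ⊆ U → ∀ X : VField M, SmoothFieldOn X V →
    SmoothFunOn (fun q => α q (X q)) V

/-- The exterior derivative `dα(X, Y) = X α(Y) - Y α(X) - α([X, Y])`, at `q`. -/
def extDerivForm (α : OneForm M) (X Y : VField M) (q : M) : ℝ :=
  fieldDeriv X (fun p => α p (Y p)) q - fieldDeriv Y (fun p => α p (X p)) q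
    - α q (VectorField.mlieBracket (𝓡 3) X Y q)

/-- At `q`, the vectors `X q`, `Y q` form an orthonormal basis of the subspace `D q` of the tangent
space, with respect to the inner product `g q` on `D q`. -/
def IsOrthonormalPairAt (D : (q : M) → Submodule ℝ (TangentSpace (𝓡 3) q))
    (g : (q : M) → (D q →ₗ[ℝ] D q →ₗ[ℝ] ℝ)) (X Y : VField M) (q : M) : Prop :=
  D q = Submodule.span ℝ {X q, Y q} ∧
    ∃ (hX : X q ∈ D q) (hY : Y q ∈ D q),
      g q ⟨X q, hX⟩ ⟨X q, hX⟩ = 1 ∧ g q ⟨Y q, hY⟩ ⟨Y q, hY⟩ = 1 ∧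
        g q ⟨X q, hX⟩ ⟨Y q, hY⟩ = 0

end Fields

/-- A sub-Riemannian structure of rank two on a three dimensional manifold: a distribution of planes
and an inner product on each of these planes. That both depend smoothly on the base point is
expressed by the existence of smooth local orthonormal frames. -/
structure SubRiemannian (M : Type*) [TopologicalSpace M] [ChartedSpace E3 M]
    [IsManifold (𝓡 3) ∞ M] where
  dist : (q : M) → Submodule ℝ (TangentSpace (𝓡 3) q)
  metric : (q : M) → (dist q →ₗ[ℝ] dist q →ₗ[ℝ] ℝ)
  metric_symm : ∀ q v w, metric q v w = metric q w v
  metric_pos : ∀ q v, v ≠ 0 → 0 < metric q v v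
  finrank_dist : ∀ q, Module.finrank ℝ (dist q) = 2
  smooth : ∀ q, ∃ U : Set M, IsOpen U ∧ q ∈ U ∧ ∃ X Y : VField M,
    SmoothFieldOn X U ∧ SmoothFieldOn Y U ∧ ∀ p ∈ U, IsOrthonormalPairAt dist metric X Y p

namespace SubRiemannian

/-! ### The Heisenberg group -/

/-- The field `f₁ = ∂_y + (x/2) ∂_z` in the coordinates `(x, y, z)`. -/
def heisField1 : VField E3 := fun q => (!₂[0, 1, q 0 / 2] : E3)

/-- The field `f₂ = ∂_x - (y/2) ∂_z` in the coordinates `(x, y, z)`. -/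
def heisField2 : VField E3 := fun q => (!₂[1, 0, -(q 1 / 2)] : E3)

/-- The plane spanned by `f₁` and `f₂`. -/
def heisDist (q : E3) : Submodule ℝ (TangentSpace (𝓡 3) q) :=
  Submodule.span ℝ {heisField1 q, heisField2 q}

/-- The inner product on `heisDist q` for which `f₁` and `f₂` are orthonormal. -/
def heisMetric (q : E3) : heisDist q →ₗ[ℝ] heisDist q →ₗ[ℝ] ℝ :=
  LinearMap.mk₂ ℝ (fun v w => (show E3 from v.1) 0 * (show E3 from w.1) 0 +
      (show E3 from v.1) 1 * (show E3 from w.1) 1)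
    (fun v v' w => by
      change ((show E3 from v.1) 0 + (show E3 from v'.1) 0) * _ +
        ((show E3 from v.1) 1 + (show E3 from v'.1) 1) * _ = _
      ring)
    (fun c v w => by
      change (c * (show E3 from v.1) 0) * _ + (c * (show E3 from v.1) 1) * _ = c * _
      ring)
    (fun v w w' => by
      change _ * ((show E3 from w.1) 0 + (show E3 from w'.1) 0) +
        _ * ((show E3 from w.1) 1 + (show E3 from w'.1) 1) = _
      ring)
    (fun c v w => by
      change _ * (c * (show E3 from w.1) 0) + _ * (c * (show E3 from w.1) 1) = c * _
      ring)

theorem heis_coords {q : E3} {v : TangentSpace (𝓡 3) q} (hv : v ∈ heisDist q) :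
    ∃ a b : ℝ, (v : E3) = !₂[b, a, a * (q 0 / 2) - b * (q 1 / 2)] := by
  obtain ⟨a, b, h⟩ := Submodule.mem_span_pair.1 hv
  refine ⟨a, b, ?_⟩
  rw [← h]
  change a • (!₂[0, 1, q 0 / 2] : E3) + b • (!₂[1, 0, -(q 1 / 2)] : E3) = _
  ext i
  fin_cases i <;> simp <;> ring

theorem smooth_heisField1 : SmoothFieldOn heisField1 Set.univ := by
  refine contMDiffOn_univ.2 ((contMDiff_vectorSpace_iff_contDiff (V := heisField1)).2 ?_)
  unfold heisField1
  rw [contDiff_euclidean]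
  intro i
  fin_cases i <;> simp <;> fun_prop

theorem smooth_heisField2 : SmoothFieldOn heisField2 Set.univ := by
  refine contMDiffOn_univ.2 ((contMDiff_vectorSpace_iff_contDiff (V := heisField2)).2 ?_)
  unfold heisField2
  rw [contDiff_euclidean]
  intro i
  fin_cases i <;> simp <;> fun_prop

/-- The sub-Riemannian structure of the Heisenberg group, in the coordinates `(x, y, z)` in which
the group law is `(x, y, z) (x', y', z') = (x + x', y + y', z + z' + (x y' - x' y) / 2)`. -/
def heisenberg : SubRiemannian E3 where
  dist := heisDist
  metric := heisMetric
  metric_symm q v w := by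
    simp only [heisMetric, LinearMap.mk₂_apply]
    ring
  metric_pos q v hv := by
    obtain ⟨v, hv'⟩ := v
    obtain ⟨a, b, h⟩ := heis_coords hv'
    simp only [heisMetric, LinearMap.mk₂_apply]
    subst h
    rcases eq_or_ne a 0 with rfl | ha
    · rcases eq_or_ne b 0 with rfl | hb
      · exfalso
        apply hv
        apply Subtype.ext
        change (!₂[0, 0, 0 * (q 0 / 2) - 0 * (q 1 / 2)] : E3) = 0
        ext i
        fin_cases i <;> simp
      · simpa using hb
    · have := mul_self_pos.2 ha
      have := mul_self_nonneg b
      simp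
      nlinarith
  finrank_dist q := by
    unfold heisDist
    have h : LinearIndependent ℝ ![(!₂[0, 1, q 0 / 2] : E3), (!₂[1, 0, -(q 1 / 2)] : E3)] := by
      rw [LinearIndependent.pair_iff]
      intro s t hst
      have h0 := congrArg (fun v : E3 => v 0) hst
      have h1 := congrArg (fun v : E3 => v 1) hst
      simp at h0 h1
      exact ⟨h1, h0⟩
    have h2 := finrank_span_eq_card h
    rw [Matrix.range_cons, Matrix.range_cons, Matrix.range_empty, Set.union_empty] at h2
    exact h2
  smooth q := by
    refine ⟨Set.univ, isOpen_univ, trivial, heisField1, heisField2, smooth_heisField1,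
      smooth_heisField2, fun p _ => ⟨rfl, Submodule.subset_span (Set.mem_insert _ _),
        Submodule.subset_span (Set.mem_insert_of_mem _ rfl), ?_, ?_, ?_⟩⟩ <;>
    simp [heisMetric, LinearMap.mk₂_apply, heisField1, heisField2]

section Conformal

variable {M : Type*} [TopologicalSpace M] [ChartedSpace E3 M] [IsManifold (𝓡 3) ∞ M]

/-- The distribution is locally the kernel of a smooth one-form `α` for which `α ∧ dα` does not
vanish. -/
def IsContact (S : SubRiemannian M) : Prop :=
  ∀ q, ∃ U : Set M, IsOpen U ∧ q ∈ U ∧ ∃ α : OneForm M, SmoothFormOn α U ∧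
    ∀ p ∈ U, (∀ v, v ∈ S.dist p ↔ α p v = 0) ∧
      ∃ X Y Z : VField M, SmoothFieldOn X U ∧ SmoothFieldOn Y U ∧ SmoothFieldOn Z U ∧
        α p (X p) * extDerivForm α Y Z p + α p (Y p) * extDerivForm α Z X p
          + α p (Z p) * extDerivForm α X Y p ≠ 0

/-- On `U`, the rescaled structure `(Δ, e^{2φ} g)` is locally isometric to the Heisenberg group:
every point of `U` has a neighbourhood in `U` with a diffeomorphism onto an open subset of the
Heisenberg group, mapping the distribution onto the Heisenberg distribution and the inner product
`e^{2φ} g` to the Heisenberg inner product. -/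
def IsAdmissible (S : SubRiemannian M) (U : Set M) (φ : M → ℝ) : Prop :=
  ∀ p ∈ U, ∃ Φ : OpenPartialHomeomorph M E3, p ∈ Φ.source ∧ Φ.source ⊆ U ∧
    ContMDiffOn (𝓡 3) (𝓡 3) ∞ Φ Φ.source ∧ ContMDiffOn (𝓡 3) (𝓡 3) ∞ Φ.symm Φ.target ∧
    ∀ q ∈ Φ.source,
      heisenberg.dist (Φ q) = (S.dist q).map (mfderiv (𝓡 3) (𝓡 3) Φ q).toLinearMap ∧
      ∀ (v w : S.dist q) (v' w' : heisenberg.dist (Φ q)),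
        (v' : TangentSpace (𝓡 3) (Φ q)) = mfderiv (𝓡 3) (𝓡 3) Φ q v →
        (w' : TangentSpace (𝓡 3) (Φ q)) = mfderiv (𝓡 3) (𝓡 3) Φ q w →
        heisenberg.metric (Φ q) v' w' = Real.exp (2 * φ q) * S.metric q v w

/-- Every point has a neighbourhood on which some smooth rescaling of the structure is locally
isometric to the Heisenberg group. -/
def IsLocallyConformallyFlat (S : SubRiemannian M) : Prop :=
  ∀ q, ∃ U : Set M, IsOpen U ∧ q ∈ U ∧ ∃ φ : M → ℝ, SmoothFunOn φ U ∧ S.IsAdmissible U φ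

/-- The fields `f₀, f₁, f₂` are smooth, `f₁, f₂` is an orthonormal frame of the distribution, and
`f₀` is the Reeb field of the contact form `α` that is normalized by `dα(f₁, f₂) = 1`, i.e. `dα` is
the area form on the distribution oriented by `f₁, f₂`. -/
def IsAdaptedFrame (S : SubRiemannian M) (f₀ f₁ f₂ : VField M) : Prop :=
  SmoothFieldOn f₀ Set.univ ∧ SmoothFieldOn f₁ Set.univ ∧ SmoothFieldOn f₂ Set.univ ∧
    (∀ q, IsOrthonormalPairAt S.dist S.metric f₁ f₂ q) ∧
    ∃ α : OneForm M, SmoothFormOn α Set.univ ∧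
      (∀ q v, v ∈ S.dist q ↔ α q v = 0) ∧
      (∀ q, extDerivForm α f₁ f₂ q = 1) ∧
      (∀ q, α q (f₀ q) = 1) ∧
      ∀ X : VField M, SmoothFieldOn X Set.univ → ∀ q, extDerivForm α f₀ X q = 0

end Conformal

end SubRiemannian

/-! ### Left-invariant structures -/

instance : ENat.LEInfty (minSmoothness ℝ 3) :=
  ⟨by rw [minSmoothness_of_isRCLikeNormedField]; exact ENat.LEInfty.out⟩

section Group

variable {G : Type*} [TopologicalSpace G] [ChartedSpace E3 G] [Group G] [LieGroup (𝓡 3) ∞ G]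

/-- The group is unimodular: `trace (ad m) = 0` for all `m` in its Lie algebra. -/
def IsUnimodularLieGroup (G : Type*) [TopologicalSpace G] [ChartedSpace E3 G] [Group G]
    [LieGroup (𝓡 3) ∞ G] : Prop :=
  ∀ m : GroupLieAlgebra (𝓡 3) G,
    LinearMap.trace ℝ (GroupLieAlgebra (𝓡 3) G) (LieAlgebra.ad ℝ (GroupLieAlgebra (𝓡 3) G) m) = 0

/-- A left-invariant frame `f₀, f₁, f₂`, as a basis of the Lie algebra. -/
abbrev LieFrame (G : Type*) [TopologicalSpace G] [ChartedSpace E3 G] [Group G]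
    [LieGroup (𝓡 3) ∞ G] : Type _ :=
  Module.Basis (Fin 3) ℝ (GroupLieAlgebra (𝓡 3) G)

namespace LieFrame

/-- The left-invariant vector field `f_i`. -/
def field (f : LieFrame G) (i : Fin 3) : VField G := mulInvariantVectorField (f i)

/-- The structure coefficients `c_{12}^k`: `[f₂, f₁] = c_{12}^0 f₀ + c_{12}^1 f₁ + c_{12}^2 f₂`. -/
def c12 (f : LieFrame G) (k : Fin 3) : ℝ := f.repr ⁅f 2, f 1⁆ k

/-- The structure coefficients `c_{10}^k`: `[f₁, f₀] = c_{10}^0 f₀ + c_{10}^1 f₁ + c_{10}^2 f₂`. -/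
def c10 (f : LieFrame G) (k : Fin 3) : ℝ := f.repr ⁅f 1, f 0⁆ k

/-- The structure coefficients `c_{20}^k`: `[f₂, f₀] = c_{20}^0 f₀ + c_{20}^1 f₁ + c_{20}^2 f₂`. -/
def c20 (f : LieFrame G) (k : Fin 3) : ℝ := f.repr ⁅f 2, f 0⁆ k

/-- The invariant `χ`, computed in the frame `f`. -/
def chi (f : LieFrame G) : ℝ :=
  Real.sqrt (-(f.c10 1 * f.c20 2) + ((f.c10 2 + f.c20 1) / 2) ^ 2)

/-- The structural equations `[f₂, f₁] = f₀ + c f₂`, `[f₁, f₀] = (2/9) c² f₂`, `[f₂, f₀] = 0`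
with `c = c_{12}^2`. -/
def StructI (f : LieFrame G) : Prop :=
  ⁅f 2, f 1⁆ = f 0 + f.c12 2 • f 2 ∧ ⁅f 1, f 0⁆ = (2 / 9 * f.c12 2 ^ 2) • f 2 ∧ ⁅f 2, f 0⁆ = 0

/-- The structural equations `[f₂, f₁] = f₀ + c f₁`, `[f₂, f₀] = -(2/9) c² f₁`, `[f₁, f₀] = 0`
with `c = c_{12}^1`. -/
def StructII (f : LieFrame G) : Prop :=
  ⁅f 2, f 1⁆ = f 0 + f.c12 1 • f 1 ∧ ⁅f 2, f 0⁆ = -(2 / 9 * f.c12 1 ^ 2) • f 1 ∧ ⁅f 1, f 0⁆ = 0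

end LieFrame

namespace SubRiemannian

/-- The distribution and the inner product are preserved by the left translations. -/
def IsLeftInvariant (S : SubRiemannian G) : Prop :=
  ∀ g h : G,
    S.dist (g * h) = (S.dist h).map (mfderiv (𝓡 3) (𝓡 3) (g * ·) h).toLinearMap ∧
    ∀ (v w : S.dist h) (v' w' : S.dist (g * h)),
      (v' : TangentSpace (𝓡 3) (g * h)) = mfderiv (𝓡 3) (𝓡 3) (g * ·) h v →
      (w' : TangentSpace (𝓡 3) (g * h)) = mfderiv (𝓡 3) (𝓡 3) (g * ·) h w →
      S.metric (g * h) v' w' = S.metric h v w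

/-- The left-invariant frame `f₀, f₁, f₂` is adapted to the structure. -/
def IsAdaptedLieFrame (S : SubRiemannian G) (f : LieFrame G) : Prop :=
  S.IsAdaptedFrame (f.field 0) (f.field 1) (f.field 2)

/-- The invariant `χ` of the structure is not zero (`χ` is the same in all adapted frames). -/
def HasNonzeroChi (S : SubRiemannian G) : Prop :=
  ∃ f : LieFrame G, S.IsAdaptedLieFrame f ∧ f.chi ≠ 0

/-- A canonical frame of a structure with `χ ≠ 0`: an adapted frame whose structural equations are
`[f₂, f₁] = f₀ + c_{12}^1 f₁ + c_{12}^2 f₂`, `[f₁, f₀] = c_{10}^2 f₂`, `[f₂, f₀] = c_{20}^1 f₁`. -/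
def IsCanonicalFrame (S : SubRiemannian G) (f : LieFrame G) : Prop :=
  S.IsAdaptedLieFrame f ∧ f.chi ≠ 0 ∧
    ⁅f 2, f 1⁆ = f 0 + f.c12 1 • f 1 + f.c12 2 • f 2 ∧
    ⁅f 1, f 0⁆ = f.c10 2 • f 2 ∧
    ⁅f 2, f 0⁆ = f.c20 1 • f 1

end SubRiemannian

end Group

end

/-!
Rotating an adapted frame in the plane makes the trace-free operator `ad f₀` anti-diagonal
(`SubRiemannian.HasNonzeroChi.exists_isCanonicalFrame`). In a canonical frame the Jacobi identity
reads `c₁₂¹ c₁₀² = c₁₂² c₂₀¹ = 0` (`canonical_jacobi`), and `c₁₂¹, c₁₂²` do not both vanish, since the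
group would be unimodular (`trace_ad_eq_zero_of_canonical`). With `χ ≠ 0` exactly one of `c₁₀²`,
`c₂₀¹` is not zero. Exchanging `f₁` and `f₂`, and changing the sign of `f₀`, interchanges the two
cases (`SubRiemannian.IsCanonicalFrame.exists_swap`), so that only frames with
`[f₂, f₁] = f₀ + β f₂`, `[f₁, f₀] = p f₂`, `[f₂, f₀] = 0` need be considered: they are the frames of
`IsStructureFrame`, on an arbitrary three-manifold. The claim becomes that conformal flatness,
with `p ≠ 0`, means `p = (2/9) β²`.

Necessity. The coordinates `(u, v, w)` of a local isometry from `e^{2φ} g` to the Heisenberg group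
satisfy a system of first-order equations whose coefficients involve `φ`. The commutation relations of
the frame turn it into expressions for the second derivatives of `φ` and for the derivatives of one
angular velocity, and the integrability condition of the latter is `p (9 p - 2 β²) = 0`. Only the
derivations `fᵢ` of the ring of smooth functions are used, and the computation is made in a commutative
ring with three derivations (`IsStructureTriple.isometry_obstruction`), which is applied to `smoothRing`
in `IsStructureFrame.obstruction`.

Sufficiency. If `p = (2/9) β²` and `f₁ φ = -β/3`, `f₂ φ = 0`, then `f₀ φ = 0`, and the equations
`f₁ x = 0`, `f₂ x = e^φ`, `f₁ y = e^φ`, `f₂ y = 0`, `f₁ z = e^φ x / 2`, `f₂ z = -e^φ y / 2`, which say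
that `(x, y, z)` maps `e^{-φ} f₁, e^{-φ} f₂` to the Heisenberg frame, prescribe closed one-forms
`dx`, `dy`, `dz` (`IsStructureFrame.exists_heisenberg_coordinates`). The Poincaré lemma in terms of a
frame (`exists_primitive_of_frame`) gives a local solution, and the inverse function theorem
(`exists_openPartialHomeomorph_of_injective_mfderiv`) shows that it is a local diffeomorphism. The
Poincaré lemma also provides `φ` itself (`IsStructureFrame.exists_conformal_factor`).
-/

noncomputable section

/-! ### Differential algebra of the conformal factor -/

section Algebra

variable {R : Type*} [CommRing R] [Algebra ℝ R]

theorem eq_zero_of_natCast_mul_eq_zero (n : ℕ) (hn : n ≠ 0) {x : R} (h : (n : R) * x = 0) :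
    x = 0 := by
  have hu : IsUnit ((algebraMap ℝ R) (n : ℝ)) :=
    (IsUnit.mk0 (n : ℝ) (Nat.cast_ne_zero.2 hn)).map (algebraMap ℝ R)
  rw [map_natCast] at hu
  exact (hu.mul_right_eq_zero).1 h

theorem Derivation.leibniz_mul (D : Derivation ℝ R R) (x y : R) :
    D (x * y) = x * D y + y * D x := by
  simp

theorem Derivation.map_ofNat (D : Derivation ℝ R R) (n : ℕ) [n.AtLeastTwo] :
    D (ofNat(n) : R) = 0 :=
  D.map_natCast n

/-- The derivations `D₀, D₁, D₂` satisfy the commutation relations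
`[D₂, D₁] = D₀ + β D₂`, `[D₁, D₀] = p D₂`, `[D₂, D₀] = 0`, in which `β` and `p` are constants of
all three derivations. -/
structure IsStructureTriple (D₀ D₁ D₂ : Derivation ℝ R R) (β p : R) : Prop where
  comm21 : ∀ x, D₂ (D₁ x) - D₁ (D₂ x) = D₀ x + β * D₂ x
  comm10 : ∀ x, D₁ (D₀ x) - D₀ (D₁ x) = p * D₂ x
  comm20 : ∀ x, D₂ (D₀ x) = D₀ (D₂ x)
  zero_beta : D₀ β = 0
  one_beta : D₁ β = 0
  two_beta : D₂ β = 0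
  one_p : D₁ p = 0
  two_p : D₂ p = 0

/-- The integrability condition of the system satisfied by the first derivatives `a, b, c` of a
conformal factor `φ`, together with an auxiliary function `τ`. The derivatives of `τ` determine
`D₀ a` and `D₀ b`; inserting these in the sum of the relations `[D₂, D₀] a = 0` and
`[D₁, D₀] b = p D₂ b` makes `a, b, c` drop out. -/
theorem IsStructureTriple.obstruction {D₀ D₁ D₂ : Derivation ℝ R R} {β p : R}
    (h : IsStructureTriple D₀ D₁ D₂ β p) {φ τ a b c : R}
    (ha : a = D₁ φ) (hb : b = D₂ φ) (hc : c = D₀ φ)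
    (h1a : 16 * D₁ a = 8 * a ^ 2 - 24 * b ^ 2 - 2 * β ^ 2 + 5 * p)
    (h2b : 16 * D₂ b = 8 * b ^ 2 - 24 * a ^ 2 - 16 * β * a - 2 * β ^ 2 - 3 * p)
    (h2a : 2 * D₂ a = 4 * a * b + 2 * β * b + c)
    (h1b : 2 * D₁ b = 4 * a * b - c)
    (hτ : 8 * τ = 24 * a ^ 2 + 24 * b ^ 2 - 2 * β ^ 2 - 3 * p)
    (h2τ : D₂ τ = 3 * D₀ a)
    (h1τ : D₁ τ + 3 * D₀ b = p * (3 * a + β)) :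
    p * (9 * p - 2 * β ^ 2) = 0 := by
  obtain ⟨c21, c10, c20, β0, β1, β2, p1, p2⟩ := h
  have D2τ := congrArg D₂ hτ
  have D1τ := congrArg D₁ hτ
  have D0e3 := congrArg D₀ h2a
  have D0e4 := congrArg D₀ h1b
  simp only [pow_two, ← mul_assoc, map_add, map_sub, Derivation.leibniz_mul,
    Derivation.map_ofNat, β0, β1, β2, p1, p2, mul_zero, zero_add] at D2τ D1τ D0e3 D0e4
  have e5 : 24 * D₀ a = 24 * (a * a * b + a * c + b * b * b) - 3 * b * (2 * β * β + 3 * p) := by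
    linear_combination -8 * h2τ + D2τ + 24 * a * h2a + 3 * b * h2b
  have e6 : 24 * D₀ b = 24 * (-(a * a * a) - a * b * b + b * c) + 3 * a * (2 * β * β + 3 * p)
      + 8 * p * β := by
    linear_combination 8 * h1τ - D1τ - 3 * a * h1a - 24 * b * h1b
  have f1 : D₁ c = D₀ a + p * b := by
    rw [ha, hb, hc]; linear_combination c10 φ
  have f2 : D₂ c = D₀ b := by rw [hb, hc, c20]
  have D2e5 := congrArg D₂ e5
  have D1e6 := congrArg D₁ e6
  simp only [map_add, map_sub, map_neg, Derivation.leibniz_mul,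
    Derivation.map_ofNat, β1, β2, p1, p2, mul_zero, zero_add] at D2e5 D1e6
  have g1 := c20 a
  have g2 := c10 b
  refine eq_zero_of_natCast_mul_eq_zero 16 (by norm_num) ?_
  push_cast
  linear_combination -16 * (D2e5 + D1e6 - 24 * g1 - 24 * g2 - 12 * D0e3 - 12 * D0e4)
    - 16 * 12 * (2 * a * b + c) * h2a
    - (24 * a ^ 2 + 72 * b ^ 2 - 3 * (2 * β * β + 3 * p) - 24 * p) * h2b
    - (24 * (-3 * a ^ 2 - b ^ 2) + 3 * (2 * β * β + 3 * p)) * h1a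
    - 16 * 12 * (c - 2 * a * b) * h1b - 16 * 24 * b * f1 - 16 * 24 * a * f2
    + 16 * 3 * b * e5 + 16 * (3 * a + β) * e6

/-- The logarithmic derivatives of a rotating vector `(A, B)` of length `√r`: if
`X A = x A - s B` and `X B = x B + s A`, and likewise for `Y`, then the relation `[X, Y] = Z`
gives the integrability condition for the angular velocities `s, t, n`. -/
theorem angular_velocity_comm {X Y Z : Derivation ℝ R R} (hZ : ∀ f, X (Y f) - Y (X f) = Z f)
    {A B r x y z s t n : R} (hr : A * A + B * B = r) (hunit : IsUnit r)
    (hxA : X A = x * A - s * B) (hxB : X B = x * B + s * A)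
    (hyA : Y A = y * A - t * B) (hyB : Y B = y * B + t * A)
    (hzA : Z A = z * A - n * B) (hzB : Z B = z * B + n * A) : X t - Y s = n := by
  have h1 := hZ A
  have h2 := hZ B
  rw [hyA, hxA, hzA] at h1
  rw [hyB, hxB, hzB] at h2
  simp only [map_add, map_sub, Derivation.leibniz_mul, hxA, hxB, hyA, hyB] at h1 h2
  have : r * (X t - Y s - n) = 0 := by
    rw [← hr]
    linear_combination A * h2 - B * h1
  linear_combination hunit.mul_right_eq_zero.1 this

/-- If `(u, v, w)` behaves like the coordinates of a map to the Heisenberg group that is horizontal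
(`h1w`, `h2w`) and conformal of factor `r` (`h11`, `h22`, `h12`), where `r` plays the role of
`e^{2φ}`, then the coefficients `β` and `p` are related. All the derivatives of `u, v, w` are
expressed by those of `φ` and by the angular velocities `t₀, t₁, t₂` of the vector `(D₁ u, D₁ v)`;
the commutation relations determine the `tᵢ`, and their integrability is the system of
`IsStructureTriple.obstruction`. -/
theorem IsStructureTriple.isometry_obstruction {D₀ D₁ D₂ : Derivation ℝ R R} {β p : R}
    (h : IsStructureTriple D₀ D₁ D₂ β p) {u v w φ r : R} (hunit : IsUnit r)
    (h1w : 2 * D₁ w = u * D₁ v - v * D₁ u) (h2w : 2 * D₂ w = u * D₂ v - v * D₂ u)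
    (h11 : D₁ u * D₁ u + D₁ v * D₁ v = r) (h22 : D₂ u * D₂ u + D₂ v * D₂ v = r)
    (h12 : D₁ u * D₂ u + D₁ v * D₂ v = 0)
    (hr0 : D₀ r = 2 * r * D₀ φ) (hr1 : D₁ r = 2 * r * D₁ φ) (hr2 : D₂ r = 2 * r * D₂ φ) :
    p * (9 * p - 2 * β ^ 2) = 0 := by
  have hh := h
  obtain ⟨c21, c10, c20, β0, β1, β2, p1, p2⟩ := h
  obtain ⟨s, hs⟩ := hunit.exists_right_inv
  have cancel : ∀ {x y : R}, r * x = r * y → x = y := fun h => hunit.mul_left_cancel h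
  have cancel2 : ∀ {x y : R}, 2 * x = 2 * y → x = y := fun {x y} h =>
    sub_eq_zero.1 (eq_zero_of_natCast_mul_eq_zero 2 two_ne_zero (by push_cast; linear_combination h))
  have Dtwo : ∀ D : Derivation ℝ R R, D 2 = 0 := fun D => D.map_ofNat 2
  set A := D₁ u with hA
  set B := D₁ v with hB
  -- `ε` is the sign of the Jacobian of `(u, v)` along `D₁, D₂`; in the ring this reads `ε ε = 1`
  obtain ⟨ε, hε⟩ : ∃ ε, r * ε = A * D₂ v - B * D₂ u :=
    ⟨s * (A * D₂ v - B * D₂ u), by linear_combination (A * D₂ v - B * D₂ u) * hs⟩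
  have hεε : ε * ε = 1 := by
    apply cancel; apply cancel
    linear_combination (r * ε + (A * D₂ v - B * D₂ u)) * hε - (A * D₂ u + B * D₂ v) * h12
      + r * h11 + (A * A + B * B) * h22
  have Dε : ∀ D : Derivation ℝ R R, D ε = 0 := by
    intro D
    have := congrArg D hεε
    rw [D.leibniz_mul, D.map_one_eq_zero] at this
    apply cancel2
    linear_combination ε * this - 2 * D ε * hεε
  have h2u : D₂ u = -ε * B := by
    apply cancel
    linear_combination A * h12 + B * hε - D₂ u * h11
  have h2v : D₂ v = ε * A := by
    apply cancel
    linear_combination B * h12 - A * hε - D₂ v * h11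
  -- the relation for `[D₂, D₁]` applied to `w` gives `D₀ w`; those for `[D₁, D₀]` and `[D₂, D₀]`
  -- then express `D₀ u` and `D₀ v` by the derivatives of `φ`
  have h0w : 2 * D₀ w = u * D₀ v - v * D₀ u - 2 * ε * r := by
    have e1 := congrArg D₂ h1w
    have e2 := congrArg D₁ h2w
    simp only [map_sub, Derivation.leibniz_mul, Dtwo] at e1 e2
    linear_combination e1 - e2 - 2 * c21 w + u * c21 v - v * c21 u - β * h2w + 2 * hε
  have X1 : 2 * ε * r * D₁ φ = A * D₀ v - B * D₀ u := by
    have e1 := congrArg D₁ h0w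
    have e2 := congrArg D₀ h1w
    simp only [map_sub, Derivation.leibniz_mul, Dtwo, Dε] at e1 e2
    apply cancel2
    linear_combination e1 - e2 - 2 * c10 w + u * c10 v - v * c10 u - p * h2w - 2 * ε * hr1
  have X2 : 2 * ε * r * D₂ φ = -ε * (B * D₀ v + A * D₀ u) := by
    have e1 := congrArg D₂ h0w
    have e2 := congrArg D₀ h2w
    simp only [map_sub, Derivation.leibniz_mul, Dtwo, Dε] at e1 e2
    apply cancel2
    linear_combination e1 - e2 - 2 * c20 w + u * c20 v - v * c20 u - 2 * ε * hr2
      + 2 * D₀ v * h2u - 2 * D₀ u * h2v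
  have h0u : D₀ u = -2 * D₂ φ * A - 2 * ε * D₁ φ * B := by
    apply cancel
    linear_combination - D₀ u * h11 + B * X1 + ε * A * X2
      - (A * (2 * r * D₂ φ + B * D₀ v + A * D₀ u)) * hεε
  have h0v : D₀ v = 2 * ε * D₁ φ * A - 2 * D₂ φ * B := by
    apply cancel
    linear_combination - D₀ v * h11 - A * X1 + ε * B * X2
      - (B * (2 * r * D₂ φ + B * D₀ v + A * D₀ u)) * hεε
  -- the angular velocities of `(A, B)`
  have hT : ∀ (D : Derivation ℝ R R), D r = 2 * r * D φ →
      ∃ t, D A = D φ * A - ε * t * B ∧ D B = D φ * B + ε * t * A := by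
    intro D hD
    have e := congrArg D h11
    simp only [map_add, Derivation.leibniz_mul] at e
    have e' : A * D A + B * D B = r * D φ := by
      apply cancel2
      linear_combination e + hD
    refine ⟨ε * s * (A * D B - B * D A), ?_, ?_⟩ <;> apply cancel
    · linear_combination -D A * h11 + A * e'
        + B * (A * D B - B * D A) * (ε * ε * hs + hεε)
    · linear_combination -D B * h11 + B * e'
        - A * (A * D B - B * D A) * (ε * ε * hs + hεε)
  obtain ⟨t1, h1A, h1B⟩ := hT D₁ hr1
  obtain ⟨t2, h2A, h2B⟩ := hT D₂ hr2
  obtain ⟨t0, h0A, h0B⟩ := hT D₀ hr0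
  -- coefficients with respect to the pair of orthogonal vectors `(A, B)`, `ε (-B, A)` are unique
  have key : ∀ {x y z w : R}, x * A - ε * y * B = z * A - ε * w * B →
      x * B + ε * y * A = z * B + ε * w * A → x = z ∧ y = w := by
    intro x y z w e1 e2
    constructor <;> apply cancel
    · linear_combination (z - x) * h11 + A * e1 + B * e2
    · linear_combination (w - y) * h11 + ε * A * e2 - ε * B * e1 - (A * A + B * B) * (y - w) * hεε
  have ht12 : D₂ φ + t1 = -2 * D₂ φ ∧ t2 - D₁ φ = 2 * D₁ φ + β := by
    have e1 := c21 u
    have e2 := c21 v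
    rw [h2u, ← hA, h0u] at e1
    rw [h2v, ← hB, h0v] at e2
    simp only [map_neg, Derivation.leibniz_mul, Dε, h1A, h1B, h2A, h2B] at e1 e2
    apply key
    · linear_combination e1 - t1 * A * hεε
    · linear_combination e2 - t1 * B * hεε
  have ht1 : t1 = -3 * D₂ φ := by linear_combination ht12.1
  have ht2 : t2 = 3 * D₁ φ + β := by linear_combination ht12.2
  obtain ⟨k1, k2⟩ : -2 * D₂ (D₂ φ) - 2 * D₂ φ * D₂ φ - 2 * D₁ φ * t2 = -t0 ∧
      2 * D₂ (D₁ φ) + 2 * D₁ φ * D₂ φ - 2 * D₂ φ * t2 = D₀ φ := by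
    have e1 := c20 u
    have e2 := c20 v
    rw [h2u, h0u] at e1
    rw [h2v, h0v] at e2
    simp only [map_neg, map_sub, Derivation.leibniz_mul, Dtwo, Dε, h0A, h0B, h2A, h2B] at e1 e2
    apply key
    · linear_combination e1 + (2 * D₁ φ * t2 * A - t0 * A) * hεε
    · linear_combination e2 + (2 * D₁ φ * t2 * B - t0 * B) * hεε
  obtain ⟨k3, k4⟩ : -2 * D₁ (D₂ φ) - 2 * D₂ φ * D₁ φ - 2 * D₁ φ * t1 - D₀ φ = 0 ∧
      2 * D₁ (D₁ φ) + 2 * D₁ φ * D₁ φ - 2 * D₂ φ * t1 - t0 = p := by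
    have e1 := c10 u
    have e2 := c10 v
    rw [h2u, h0u, ← hA, h0A] at e1
    rw [h2v, h0v, ← hB, h0B] at e2
    simp only [map_neg, map_sub, Derivation.leibniz_mul, Dtwo, Dε, h1A, h1B] at e1 e2
    apply key
    · linear_combination e1 + (2 * D₁ φ * t1 * A) * hεε
    · linear_combination e2 + (2 * D₁ φ * t1 * B) * hεε
  -- the integrability conditions for the angular velocities
  have hεt : ∀ {D : Derivation ℝ R R} {t : R}, D (ε * t) = ε * D t := by
    intro D t
    rw [D.leibniz_mul, Dε, mul_zero, add_zero]
  have m21 := angular_velocity_comm (X := D₂) (Y := D₁) (Z := D₀ + β • D₂)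
    (z := D₀ φ + β * D₂ φ) (n := ε * (t0 + β * t2)) c21 h11 hunit h2A h2B h1A h1B
    (by change D₀ A + β * D₂ A = _; rw [h0A, h2A]; ring)
    (by change D₀ B + β * D₂ B = _; rw [h0B, h2B]; ring)
  have m10 := angular_velocity_comm (X := D₁) (Y := D₀) (Z := p • D₂)
    (z := p * D₂ φ) (n := ε * (p * t2)) c10 h11 hunit h1A h1B h0A h0B
    (by change p * D₂ A = _; rw [h2A]; ring)
    (by change p * D₂ B = _; rw [h2B]; ring)
  have m20 := angular_velocity_comm (X := D₂) (Y := D₀) (Z := 0)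
    (z := 0) (n := 0) (fun f => sub_eq_zero.2 (c20 f)) h11 hunit h2A h2B h0A h0B (by simp) (by simp)
  rw [hεt, hεt] at m21 m10 m20
  have cancelε : ∀ {x y : R}, ε * x = ε * y → x = y := by
    intro x y h
    linear_combination ε * h - (x - y) * hεε
  have n21 : D₂ t1 - D₁ t2 = t0 + β * t2 := cancelε (by linear_combination m21)
  have n10 : D₁ t0 - D₀ t1 = p * t2 := cancelε (by linear_combination m10)
  have n20 : D₂ t0 - D₀ t2 = 0 := cancelε (by linear_combination m20)
  subst ht1 ht2
  have hneg3 : ∀ (D : Derivation ℝ R R) (x : R), D (-3 * x) = -3 * D x := by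
    intro D x
    rw [neg_mul, map_neg, D.leibniz_mul, D.map_ofNat]; ring
  have hthree : ∀ (D : Derivation ℝ R R) (x : R), D (3 * x + β) = 3 * D x + D β := by
    intro D x
    rw [map_add, D.leibniz_mul, D.map_ofNat]; ring
  rw [hneg3, hthree, β1] at n21
  rw [hneg3] at n10
  rw [hthree, β0] at n20
  have hτ : 8 * t0 = 24 * D₁ φ ^ 2 + 24 * D₂ φ ^ 2 - 2 * β ^ 2 - 3 * p := by
    linear_combination -2 * n21 + 3 * k1 - 3 * k4
  refine hh.obstruction (φ := φ) (τ := t0) rfl rfl rfl ?_ ?_ ?_ ?_ ?_ ?_ ?_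
  · linear_combination 8 * k4 + hτ
  · linear_combination -8 * k1 + hτ
  · linear_combination k2
  · linear_combination -k3
  · exact hτ
  · linear_combination n20
  · linear_combination n10

end Algebra

/-! ### Vector fields in a chart -/

theorem fderiv_comm_eq_lieBracket {E : Type*} [NormedAddCommGroup E] [NormedSpace ℝ E] {f : E → ℝ}
    {V W : E → E} {x : E} (hf : ContDiffAt ℝ 2 f x) (hV : DifferentiableAt ℝ V x)
    (hW : DifferentiableAt ℝ W x) :
    fderiv ℝ (fun y => fderiv ℝ f y (W y)) x (V x) - fderiv ℝ (fun y => fderiv ℝ f y (V y)) x (W x) =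
      fderiv ℝ f x (VectorField.lieBracket ℝ V W x) := by
  have hd : DifferentiableAt ℝ (fderiv ℝ f) x :=
    (hf.fderiv_right (m := 1) (by norm_num)).differentiableAt (by norm_num)
  rw [fderiv_clm_apply hd hW, fderiv_clm_apply hd hV, VectorField.lieBracket]
  have := (hf.isSymmSndFDerivAt (by simp)) (V x) (W x)
  simp [this]

section Functions

variable {M : Type*} [TopologicalSpace M] [ChartedSpace E3 M] {X Y : VField M} {U : Set M}
  {φ χ : M → ℝ} {q : M}

theorem SmoothFunOn.of_forall_mem (h : ∀ q ∈ U, ∃ V, IsOpen V ∧ q ∈ V ∧ SmoothFunOn φ (U ∩ V)) :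
    SmoothFunOn φ U := by
  intro q hq
  obtain ⟨V, hV, hqV, h⟩ := h q hq
  exact (h q ⟨hq, hqV⟩).mono_of_mem_nhdsWithin
    (Filter.inter_mem self_mem_nhdsWithin (nhdsWithin_le_nhds (hV.mem_nhds hqV)))

theorem SmoothFunOn.congr (h : SmoothFunOn φ U) (hχ : ∀ q ∈ U, χ q = φ q) : SmoothFunOn χ U :=
  ContMDiffOn.congr h hχ

theorem SmoothFunOn.mdifferentiableAt (hφ : SmoothFunOn φ U) (hU : IsOpen U) (hq : q ∈ U) :
    MDifferentiableAt (𝓡 3) 𝓘(ℝ, ℝ) φ q :=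
  (hφ.contMDiffAt (hU.mem_nhds hq)).mdifferentiableAt (by simp)

theorem fieldDeriv_congr (h : φ =ᶠ[nhds q] χ) : fieldDeriv X φ q = fieldDeriv X χ q := by
  rw [fieldDeriv, h.mfderiv_eq]; rfl

theorem fieldDeriv_const (r : ℝ) : fieldDeriv X (fun _ => r) q = 0 := by
  rw [fieldDeriv, mfderiv_const]
  rfl

theorem fieldDeriv_add (hφ : MDifferentiableAt (𝓡 3) 𝓘(ℝ, ℝ) φ q)
    (hχ : MDifferentiableAt (𝓡 3) 𝓘(ℝ, ℝ) χ q) :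
    fieldDeriv X (fun p => φ p + χ p) q = fieldDeriv X φ q + fieldDeriv X χ q := by
  have := (hφ.hasMFDerivAt.add hχ.hasMFDerivAt).mfderiv
  rw [fieldDeriv]
  erw [this]
  rfl

theorem fieldDeriv_mul (hφ : MDifferentiableAt (𝓡 3) 𝓘(ℝ, ℝ) φ q)
    (hχ : MDifferentiableAt (𝓡 3) 𝓘(ℝ, ℝ) χ q) :
    fieldDeriv X (fun p => φ p * χ p) q = φ q * fieldDeriv X χ q + χ q * fieldDeriv X φ q := by
  have := (hφ.hasMFDerivAt.mul hχ.hasMFDerivAt).mfderiv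
  rw [fieldDeriv]
  erw [this]
  rfl

theorem fieldDeriv_comp {f : ℝ → ℝ} {f' : ℝ} (hf : HasDerivAt f f' (φ q))
    (hφ : MDifferentiableAt (𝓡 3) 𝓘(ℝ, ℝ) φ q) :
    fieldDeriv X (fun p => f (φ p)) q = f' * fieldDeriv X φ q := by
  have := ((hf.hasFDerivAt.hasMFDerivAt).comp q hφ.hasMFDerivAt).mfderiv
  rw [fieldDeriv]
  erw [this]
  exact mul_comm _ _

theorem SmoothFunOn.real_comp {f : ℝ → ℝ} (hf : ContDiff ℝ ∞ f) (hφ : SmoothFunOn φ U) :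
    SmoothFunOn (fun p => f (φ p)) U :=
  hf.contMDiff.comp_contMDiffOn hφ

end Functions

section Charts

open VectorField

variable {M : Type*} [TopologicalSpace M] [ChartedSpace E3 M] [IsManifold (𝓡 3) ∞ M]

/-- The expression of the vector field `X` in the chart `e`, as a vector field on the image of the
chart. -/
def chartField (e : OpenPartialHomeomorph M E3) (X : VField M) : E3 → E3 :=
  mpullback (𝓡 3) (𝓡 3) e.symm X

variable {e : OpenPartialHomeomorph M E3} {X Y : VField M} {U : Set M} {φ χ : M → ℝ} {q : M}

theorem contMDiffAt_symm_of_mem_atlas (he : e ∈ atlas E3 M) {x : E3} (hx : x ∈ e.target) :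
    ContMDiffAt (𝓡 3) (𝓡 3) ∞ e.symm x :=
  (contMDiffOn_symm_of_mem_maximalAtlas (IsManifold.subset_maximalAtlas he)).contMDiffAt
    (e.open_target.mem_nhds hx)

theorem isInvertible_mfderiv_symm_of_mem_atlas (he : e ∈ atlas E3 M) {x : E3} (hx : x ∈ e.target) :
    (mfderiv (𝓡 3) (𝓡 3) e.symm x).IsInvertible := by
  exact ⟨(mdifferentiable_of_mem_atlas he).symm.mfderiv hx, rfl⟩

theorem fieldDeriv_eq_fderiv (he : e ∈ atlas E3 M) (hq : q ∈ e.source)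
    (hφ : MDifferentiableAt (𝓡 3) 𝓘(ℝ, ℝ) φ q) :
    fieldDeriv X φ q = fderiv ℝ (φ ∘ e.symm) (e q) (chartField e X (e q)) := by
  have hx : e q ∈ e.target := e.map_source hq
  obtain ⟨x, hx', rfl⟩ : ∃ x ∈ e.target, e.symm x = q := ⟨e q, hx, e.left_inv hq⟩
  rw [e.right_inv hx']
  have hs := (contMDiffAt_symm_of_mem_atlas he hx').mdifferentiableAt (by simp)
  have := mfderiv_comp x hφ hs
  rw [← mfderiv_eq_fderiv, this]
  simp only [fieldDeriv, chartField, mpullback_apply]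
  obtain ⟨L, hL⟩ := isInvertible_mfderiv_symm_of_mem_atlas he hx'
  change _ = mfderiv (𝓡 3) 𝓘(ℝ, ℝ) φ (e.symm x) (mfderiv (𝓡 3) (𝓡 3) e.symm x _)
  rw [← hL, ContinuousLinearMap.inverse_equiv]
  simp

theorem SmoothFieldOn.contDiffOn_chartField (he : e ∈ atlas E3 M) (hU : IsOpen U)
    (hX : SmoothFieldOn X U) :
    ContDiffOn ℝ ∞ (chartField e X) (e.target ∩ e.symm ⁻¹' U) := by
  intro x hx
  have := ContMDiffAt.mpullback_vectorField_preimage (n := ∞) (hX.contMDiffAt (hU.mem_nhds hx.2))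
    (contMDiffAt_symm_of_mem_atlas he hx.1) (isInvertible_mfderiv_symm_of_mem_atlas he hx.1)
    le_rfl
  exact ((contMDiffAt_vectorSpace_iff_contDiffAt).1 this).contDiffWithinAt

theorem chartField_mlieBracket (he : e ∈ atlas E3 M) (hq : q ∈ e.source) (hU : U ∈ nhds q)
    (hX : SmoothFieldOn X U) (hY : SmoothFieldOn Y U) :
    chartField e (mlieBracket (𝓡 3) X Y) (e q) =
      lieBracket ℝ (chartField e X) (chartField e Y) (e q) := by
  have hX' := (hX.contMDiffAt hU).mdifferentiableAt (by simp)
  have hY' := (hY.contMDiffAt hU).mdifferentiableAt (by simp)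
  rw [← e.left_inv hq] at hX' hY'
  have := mpullback_mlieBracket (n := ∞) hX' hY'
    (contMDiffAt_symm_of_mem_atlas he (e.map_source hq)) (by
      rw [minSmoothness_of_isRCLikeNormedField]; exact ENat.LEInfty.out)
  rw [chartField, this, ← mlieBracketWithin_univ, mlieBracketWithin_eq_lieBracketWithin]
  exact congrFun lieBracketWithin_univ (e q)

theorem SmoothFunOn.contDiffOn_comp_symm (he : e ∈ atlas E3 M) (hφ : SmoothFunOn φ U) :
    ContDiffOn ℝ ∞ (φ ∘ e.symm) (e.target ∩ e.symm ⁻¹' U) := by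
  rw [← contMDiffOn_iff_contDiffOn]
  exact ContMDiffOn.comp hφ ((contMDiffOn_symm_of_mem_maximalAtlas
    (IsManifold.subset_maximalAtlas he)).mono Set.inter_subset_left) fun _ hx => hx.2

theorem ContDiffOn.smoothFunOn_comp (he : e ∈ atlas E3 M) {f : E3 → ℝ} {s : Set E3}
    (hf : ContDiffOn ℝ ∞ f s) : SmoothFunOn (f ∘ e) (e.source ∩ e ⁻¹' s) :=
  (contMDiffOn_iff_contDiffOn.2 hf).comp ((contMDiffOn_of_mem_maximalAtlas
    (IsManifold.subset_maximalAtlas he)).mono Set.inter_subset_left) fun _ hx => hx.2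

theorem SmoothFunOn.fieldDeriv (hU : IsOpen U) (hX : SmoothFieldOn X U) (hφ : SmoothFunOn φ U) :
    SmoothFunOn (fieldDeriv X φ) U := by
  refine SmoothFunOn.of_forall_mem fun q hq => ?_
  set e := chartAt E3 q with he'
  have he : e ∈ atlas E3 M := chart_mem_atlas E3 q
  refine ⟨e.source, e.open_source, mem_chart_source E3 q, ?_⟩
  have hs : IsOpen (e.target ∩ e.symm ⁻¹' U) := e.isOpen_inter_preimage_symm hU
  have h1 := hφ.contDiffOn_comp_symm he
  have h2 := (h1.fderiv_of_isOpen hs (m := ∞) le_rfl).clm_apply (hX.contDiffOn_chartField he hU)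
  refine ((h2.smoothFunOn_comp he).congr ?_).mono ?_
  · intro p hp
    exact fieldDeriv_eq_fderiv he hp.1
      (hφ.mdifferentiableAt hU (by simpa [e.left_inv hp.1] using hp.2.2))
  · intro p hp
    exact ⟨hp.2, e.map_source hp.2, by simpa [e.left_inv hp.2] using hp.1⟩

/-- A smooth function satisfies `X (Y φ) - Y (X φ) = [X, Y] φ`. -/
theorem fieldDeriv_comm (hU : IsOpen U) (hX : SmoothFieldOn X U) (hY : SmoothFieldOn Y U)
    (hφ : SmoothFunOn φ U) (hq : q ∈ U) :
    fieldDeriv X (fieldDeriv Y φ) q - fieldDeriv Y (fieldDeriv X φ) q =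
      fieldDeriv (mlieBracket (𝓡 3) X Y) φ q := by
  set e := chartAt E3 q with he'
  have he : e ∈ atlas E3 M := chart_mem_atlas E3 q
  have hqs : q ∈ e.source := mem_chart_source E3 q
  have hs : IsOpen (e.target ∩ e.symm ⁻¹' U) := e.isOpen_inter_preimage_symm hU
  have hxs : e q ∈ e.target ∩ e.symm ⁻¹' U := ⟨e.map_source hqs, by simpa [e.left_inv hqs]⟩
  have h1 := hφ.contDiffOn_comp_symm he
  have key : ∀ {Z : VField M}, SmoothFieldOn Z U →
      fieldDeriv Z φ ∘ e.symm =ᶠ[nhds (e q)]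
        fun y => fderiv ℝ (φ ∘ e.symm) y (chartField e Z y) := by
    intro Z hZ
    filter_upwards [hs.mem_nhds hxs] with y hy
    rw [Function.comp_apply, fieldDeriv_eq_fderiv he (e.map_target hy.1)
      (hφ.mdifferentiableAt hU hy.2), e.right_inv hy.1]
  rw [fieldDeriv_eq_fderiv he hqs ((hφ.fieldDeriv hU hY).mdifferentiableAt hU hq),
    fieldDeriv_eq_fderiv he hqs ((hφ.fieldDeriv hU hX).mdifferentiableAt hU hq),
    fieldDeriv_eq_fderiv he hqs (hφ.mdifferentiableAt hU hq), (key hX).fderiv_eq,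
    (key hY).fderiv_eq, chartField_mlieBracket he hqs (hU.mem_nhds hq) hX hY]
  have hd : ∀ {Z : VField M}, SmoothFieldOn Z U → DifferentiableAt ℝ (chartField e Z) (e q) :=
    fun hZ => ((hZ.contDiffOn_chartField he hU).contDiffAt (hs.mem_nhds hxs)).differentiableAt
      (by simp)
  exact fderiv_comm_eq_lieBracket ((h1.contDiffAt (hs.mem_nhds hxs)).of_le ENat.LEInfty.out)
    (hd hX) (hd hY)

end Charts

/-! ### The Poincaré lemma and the inverse function theorem -/

open VectorField

theorem LinearIndependent.isInvertible_sum_smulRight {y : Fin 3 → E3} (h : LinearIndependent ℝ y) :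
    (∑ i, (EuclideanSpace.proj i : E3 →L[ℝ] ℝ).smulRight (y i)).IsInvertible := by
  set T : E3 →L[ℝ] E3 := ∑ i, (EuclideanSpace.proj i : E3 →L[ℝ] ℝ).smulRight (y i) with hT
  have hinj : Function.Injective T.toLinearMap := by
    rw [injective_iff_map_eq_zero]
    intro v hv
    have h' := Fintype.linearIndependent_iff.1 h (fun i => v i) (by simpa [hT] using hv)
    ext i
    exact h' i
  refine ⟨(LinearEquiv.ofInjectiveEndo T.toLinearMap hinj).toContinuousLinearEquiv, ?_⟩
  ext1 v
  rfl

/-- The Poincaré lemma for a one-form `η` given by its values `a i` on a frame `Y`: closedness is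
expressed by the structure functions of the frame. -/
theorem exists_primitive_of_frame_vectorSpace {s : Set E3} (hs : IsOpen s) {x₀ : E3} (hx₀ : x₀ ∈ s)
    {Y : Fin 3 → E3 → E3} (hY : ∀ i, ContDiffOn ℝ ∞ (Y i) s)
    (hli : ∀ x ∈ s, LinearIndependent ℝ (fun i => Y i x)) {a : Fin 3 → E3 → ℝ}
    (ha : ∀ i, ContDiffOn ℝ ∞ (a i) s)
    (hint : ∀ i j, ∀ x ∈ s, ∃ c : Fin 3 → ℝ,
      lieBracket ℝ (Y i) (Y j) x = ∑ k, c k • Y k x ∧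
      fderiv ℝ (a j) x (Y i x) - fderiv ℝ (a i) x (Y j x) = ∑ k, c k * a k x) :
    ∃ t ⊆ s, IsOpen t ∧ x₀ ∈ t ∧ ∃ h : E3 → ℝ, ContDiffOn ℝ ∞ h t ∧
      ∀ x ∈ t, ∀ i, fderiv ℝ h x (Y i x) = a i x := by
  set T : E3 → E3 →L[ℝ] E3 := fun x =>
    ∑ i, (EuclideanSpace.proj i : E3 →L[ℝ] ℝ).smulRight (Y i x) with hT
  set A : E3 → E3 →L[ℝ] ℝ := fun x => ∑ i, a i x • (EuclideanSpace.proj i : E3 →L[ℝ] ℝ) with hA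
  set η : E3 → E3 →L[ℝ] ℝ := fun x => (A x).comp (T x).inverse with hη
  have hTinv : ∀ x ∈ s, (T x).IsInvertible := fun x hx => (hli x hx).isInvertible_sum_smulRight
  have hTs : ContDiffOn ℝ ∞ T s := ContDiffOn.sum fun i _ =>
    (ContinuousLinearMap.smulRightL ℝ E3 E3 (EuclideanSpace.proj i)).contDiff.comp_contDiffOn (hY i)
  have hAs : ContDiffOn ℝ ∞ A s := ContDiffOn.sum fun i _ => (ha i).smul contDiffOn_const
  have hηs : ContDiffOn ℝ ∞ η s := by
    refine hAs.clm_comp fun x hx => ?_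
    exact ((hTinv x hx).contDiffAt_map_inverse).comp_contDiffWithinAt x (hTs x hx)
  have hηY : ∀ x ∈ s, ∀ i, η x (Y i x) = a i x := by
    intro x hx i
    obtain ⟨L, hL⟩ := hTinv x hx
    have hLi : L (EuclideanSpace.single i 1) = Y i x := by
      change (L : E3 →L[ℝ] E3) _ = _
      rw [hL]
      simp [hT, PiLp.single_apply]
    rw [hη]
    simp only [ContinuousLinearMap.comp_apply]
    rw [← hL, ContinuousLinearMap.inverse_equiv, ← hLi]
    simp [hA, PiLp.single_apply]
  have hdη : ∀ x ∈ s, ∀ v w, fderiv ℝ η x v w = fderiv ℝ η x w v := by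
    intro x hx
    have hnx := hs.mem_nhds hx
    have dη : DifferentiableAt ℝ η x := (hηs.contDiffAt hnx).differentiableAt (by simp)
    have dY : ∀ i, DifferentiableAt ℝ (Y i) x := fun i =>
      ((hY i).contDiffAt hnx).differentiableAt (by simp)
    have hda : ∀ i, fderiv ℝ (a i) x = fderiv ℝ (fun y => η y (Y i y)) x := by
      intro i
      refine Filter.EventuallyEq.fderiv_eq ?_
      filter_upwards [hnx] with y hy
      exact (hηY y hy i).symm
    have hsymm : ∀ i j, fderiv ℝ η x (Y i x) (Y j x) = fderiv ℝ η x (Y j x) (Y i x) := by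
      intro i j
      obtain ⟨c, hc, hc'⟩ := hint i j x hx
      have h1 : η x (lieBracket ℝ (Y i) (Y j) x) = ∑ k, c k * a k x := by
        rw [hc, map_sum]
        exact Finset.sum_congr rfl fun k _ => by rw [map_smul, hηY x hx, smul_eq_mul]
      rw [hda, hda, fderiv_clm_apply dη (dY j), fderiv_clm_apply dη (dY i), ← h1, lieBracket,
        map_sub] at hc'
      simp only [add_apply, ContinuousLinearMap.comp_apply,
        ContinuousLinearMap.flip_apply] at hc'
      linarith
    have hspan : ∀ v, ∃ c : Fin 3 → ℝ, v = ∑ i, c i • Y i x := by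
      intro v
      obtain ⟨L, hL⟩ := hTinv x hx
      refine ⟨fun i => L.symm v i, ?_⟩
      conv_lhs => rw [← L.apply_symm_apply v]
      change (L : E3 →L[ℝ] E3) _ = _
      rw [hL]
      simp [hT]
    intro v w
    obtain ⟨c, rfl⟩ := hspan v
    obtain ⟨d, rfl⟩ := hspan w
    simp only [map_sum, map_smul, sum_apply, smul_apply, Finset.smul_sum]
    rw [Finset.sum_comm]
    refine Finset.sum_congr rfl fun j _ => Finset.sum_congr rfl fun i _ => ?_
    rw [smul_comm, hsymm]
  obtain ⟨ρ, hρ, hball⟩ := Metric.isOpen_iff.1 hs x₀ hx₀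
  obtain ⟨h, hh⟩ := (convex_ball x₀ ρ).exists_forall_hasFDerivAt_of_fderiv_symmetric
    Metric.isOpen_ball ((hηs.mono hball).differentiableOn (by simp)) fun x hx => hdη x (hball hx)
  refine ⟨_, hball, Metric.isOpen_ball, Metric.mem_ball_self hρ, h, ?_, ?_⟩
  · rw [contDiffOn_infty_iff_fderiv_of_isOpen Metric.isOpen_ball]
    exact ⟨fun x hx => (hh x hx).differentiableAt.differentiableWithinAt,
      (hηs.mono hball).congr fun x hx => (hh x hx).fderiv⟩
  · intro x hx i
    rw [(hh x hx).fderiv, hηY x (hball hx)]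

section Local

variable {M : Type*} [TopologicalSpace M] [ChartedSpace E3 M] [IsManifold (𝓡 3) ∞ M]

/-- The Poincaré lemma on a manifold, for a one-form given by its values `a i` on a frame `X`. -/
theorem exists_primitive_of_frame {U : Set M} (hU : IsOpen U) {q : M} (hq : q ∈ U)
    {X : Fin 3 → VField M} (hX : ∀ i, SmoothFieldOn (X i) U)
    (hli : ∀ p ∈ U, LinearIndependent ℝ (fun i => X i p)) {a : Fin 3 → M → ℝ}
    (ha : ∀ i, SmoothFunOn (a i) U)
    (hint : ∀ i j, ∀ p ∈ U, ∃ c : Fin 3 → ℝ,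
      mlieBracket (𝓡 3) (X i) (X j) p = ∑ k, c k • X k p ∧
      fieldDeriv (X i) (a j) p - fieldDeriv (X j) (a i) p = ∑ k, c k * a k p) :
    ∃ V ⊆ U, IsOpen V ∧ q ∈ V ∧ ∃ φ : M → ℝ, SmoothFunOn φ V ∧
      ∀ p ∈ V, ∀ i, fieldDeriv (X i) φ p = a i p := by
  set e := chartAt E3 q with he'
  have he : e ∈ atlas E3 M := chart_mem_atlas E3 q
  have hqs : q ∈ e.source := mem_chart_source E3 q
  have hs : IsOpen (e.target ∩ e.symm ⁻¹' U) := e.isOpen_inter_preimage_symm hU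
  have hxs : e q ∈ e.target ∩ e.symm ⁻¹' U := ⟨e.map_source hqs, by simpa [e.left_inv hqs]⟩
  obtain ⟨t, hts, ht, hqt, h, hh, hder⟩ := exists_primitive_of_frame_vectorSpace hs hxs
    (Y := fun i => chartField e (X i)) (fun i => (hX i).contDiffOn_chartField he hU)
    (a := fun i => a i ∘ e.symm) (by
      intro x hx
      obtain ⟨L, hL⟩ := isInvertible_mfderiv_symm_of_mem_atlas he hx.1
      have : (fun i => chartField e (X i) x) = fun i => L.symm (X i (e.symm x)) := by
        funext i
        rw [chartField, mpullback_apply, ← hL, ContinuousLinearMap.inverse_equiv]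
        rfl
      rw [this]
      exact (hli _ hx.2).map' L.symm.toLinearMap (LinearEquiv.ker L.symm.toLinearEquiv))
    (fun i => (ha i).contDiffOn_comp_symm he) (by
      intro i j x hx
      obtain ⟨c, hc, hc'⟩ := hint i j _ hx.2
      have hes : e.symm x ∈ e.source := e.map_target hx.1
      refine ⟨c, ?_, ?_⟩
      · have := chartField_mlieBracket he hes (hU.mem_nhds hx.2) (hX i) (hX j)
        rw [e.right_inv hx.1] at this
        rw [← this, chartField, mpullback_apply, hc, map_sum]
        exact Finset.sum_congr rfl fun k _ => map_smul _ _ _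
      · rw [fieldDeriv_eq_fderiv he hes ((ha j).mdifferentiableAt hU hx.2),
          fieldDeriv_eq_fderiv he hes ((ha i).mdifferentiableAt hU hx.2), e.right_inv hx.1] at hc'
        exact hc')
  refine ⟨e.source ∩ e ⁻¹' t, ?_, e.isOpen_inter_preimage ht, ⟨hqs, hqt⟩, h ∘ e,
    hh.smoothFunOn_comp he, ?_⟩
  · intro p hp
    simpa [e.left_inv hp.1] using (hts hp.2).2
  · intro p hp i
    have hm := (hh.smoothFunOn_comp he).mdifferentiableAt (e.isOpen_inter_preimage ht) hp
    have hev : (h ∘ e) ∘ e.symm =ᶠ[nhds (e p)] h := by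
      filter_upwards [e.open_target.mem_nhds (e.map_source hp.1)] with y hy
      simp [e.right_inv hy]
    rw [fieldDeriv_eq_fderiv he hp.1 hm, hev.fderiv_eq, hder _ hp.2 i]
    simp [e.left_inv hp.1]

/-- The inverse function theorem on a manifold modelled on `ℝ³`. -/
theorem exists_openPartialHomeomorph_of_injective_mfderiv {V : Set M} (hV : IsOpen V) {q : M}
    (hq : q ∈ V) {F : M → E3} (hF : ContMDiffOn (𝓡 3) (𝓡 3) ∞ F V)
    (hinj : ∀ p ∈ V, Function.Injective (mfderiv (𝓡 3) (𝓡 3) F p)) :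
    ∃ Φ : OpenPartialHomeomorph M E3, q ∈ Φ.source ∧ Φ.source ⊆ V ∧ (∀ p ∈ Φ.source, Φ p = F p) ∧
      ContMDiffOn (𝓡 3) (𝓡 3) ∞ Φ Φ.source ∧ ContMDiffOn (𝓡 3) (𝓡 3) ∞ Φ.symm Φ.target := by
  set e := chartAt E3 q with he'
  have he : e ∈ atlas E3 M := chart_mem_atlas E3 q
  have hqs : q ∈ e.source := mem_chart_source E3 q
  have hs : IsOpen (e.target ∩ e.symm ⁻¹' V) := e.isOpen_inter_preimage_symm hV
  have hxs : e q ∈ e.target ∩ e.symm ⁻¹' V := ⟨e.map_source hqs, by simpa [e.left_inv hqs]⟩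
  have hf : ContDiffOn ℝ ∞ (F ∘ e.symm) (e.target ∩ e.symm ⁻¹' V) := by
    rw [← contMDiffOn_iff_contDiffOn]
    exact hF.comp ((contMDiffOn_symm_of_mem_maximalAtlas
      (IsManifold.subset_maximalAtlas he)).mono Set.inter_subset_left) fun _ hx => hx.2
  have hder : ∀ x ∈ e.target ∩ e.symm ⁻¹' V, ∃ L : E3 ≃L[ℝ] E3,
      HasFDerivAt (F ∘ e.symm) (L : E3 →L[ℝ] E3) x := by
    intro x hx
    have hd : HasFDerivAt (F ∘ e.symm) (fderiv ℝ (F ∘ e.symm) x) x :=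
      ((hf.contDiffAt (hs.mem_nhds hx)).differentiableAt (by simp)).hasFDerivAt
    have hi : Function.Injective (fderiv ℝ (F ∘ e.symm) x).toLinearMap := by
      have h1 := mfderiv_comp x ((hF.contMDiffAt (hV.mem_nhds hx.2)).mdifferentiableAt (by simp))
        ((contMDiffAt_symm_of_mem_atlas he hx.1).mdifferentiableAt (by simp))
      rw [mfderiv_eq_fderiv] at h1
      obtain ⟨L, hL⟩ := isInvertible_mfderiv_symm_of_mem_atlas he hx.1
      have h2 : ∀ v : E3, fderiv ℝ (F ∘ e.symm) x v =
          mfderiv (𝓡 3) (𝓡 3) F (e.symm x) (L v) := by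
        intro v
        rw [h1, ← hL]
        rfl
      intro v w hvw
      exact L.injective (hinj _ hx.2 (by rw [← h2, ← h2]; exact hvw))
    exact ⟨(LinearEquiv.ofInjectiveEndo _ hi).toContinuousLinearEquiv, hd⟩
  obtain ⟨L, hL⟩ := hder _ hxs
  set Ψ := (hf.contDiffAt (hs.mem_nhds hxs)).toOpenPartialHomeomorph (F ∘ e.symm) hL (by simp)
    with hΨ
  have hΨq : e q ∈ Ψ.source :=
    (hf.contDiffAt (hs.mem_nhds hxs)).mem_toOpenPartialHomeomorph_source hL (by simp)
  have hsrc : ∀ p, p ∈ ((e.trans Ψ).restrOpen V hV).source ↔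
      (p ∈ e.source ∧ e p ∈ Ψ.source) ∧ p ∈ V := by
    intro p
    simp
  have hcoe : ∀ p ∈ ((e.trans Ψ).restrOpen V hV).source,
      ((e.trans Ψ).restrOpen V hV) p = F p := by
    intro p hp
    change F (e.symm (e p)) = F p
    rw [e.left_inv ((hsrc p).1 hp).1.1]
  have hsub : ((e.trans Ψ).restrOpen V hV).source ⊆ V := fun p hp => ((hsrc p).1 hp).2
  refine ⟨(e.trans Ψ).restrOpen V hV, (hsrc q).2 ⟨⟨hqs, hΨq⟩, hq⟩, hsub, hcoe,
    (hF.mono hsub).congr hcoe, ?_⟩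
  intro y hy
  set Φ := (e.trans Ψ).restrOpen V hV with hΦ
  have hy' : (y ∈ Ψ.target ∧ Ψ.symm y ∈ e.target) ∧ e.symm (Ψ.symm y) ∈ V := by
    simpa [hΦ] using hy
  have hyt : y ∈ Ψ.target := hy'.1.1
  have hx1 : Ψ.symm y ∈ e.target := hy'.1.2
  have hx : Ψ.symm y ∈ e.target ∩ e.symm ⁻¹' V := ⟨hx1, hy'.2⟩
  obtain ⟨L', hL'⟩ := hder _ hx
  have h1 : ContDiffAt ℝ ∞ Ψ.symm y :=
    Ψ.contDiffAt_symm hyt hL' (hf.contDiffAt (hs.mem_nhds hx))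
  exact ((contMDiffAt_symm_of_mem_atlas he hx1).comp y h1.contMDiffAt).contMDiffWithinAt

end Local

/-! ### Smooth functions as a differential ring -/

section SmoothRing

variable {M : Type*} [TopologicalSpace M] [ChartedSpace E3 M]

/-- The ring of smooth functions on `V`, realized as the restrictions to `V` of functions on `M`
that are smooth on `V`. -/
def smoothRing (V : Set M) : Subalgebra ℝ (V → ℝ) where
  carrier := {g | ∃ φ : M → ℝ, SmoothFunOn φ V ∧ V.domRestrict φ = g}
  mul_mem' := by
    rintro _ _ ⟨φ, hφ, rfl⟩ ⟨χ, hχ, rfl⟩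
    exact ⟨fun p => φ p * χ p, ContMDiffOn.mul hφ hχ, rfl⟩
  add_mem' := by
    rintro _ _ ⟨φ, hφ, rfl⟩ ⟨χ, hχ, rfl⟩
    exact ⟨fun p => φ p + χ p, ContMDiffOn.add hφ hχ, rfl⟩
  algebraMap_mem' r := ⟨fun _ => r, contMDiffOn_const, rfl⟩

/-- The element of `smoothRing V` given by a function that is smooth on `V`. -/
def SmoothFunOn.toRing {V : Set M} {φ : M → ℝ} (hφ : SmoothFunOn φ V) : smoothRing V :=
  ⟨V.domRestrict φ, φ, hφ, rfl⟩

variable {X Y : VField M} {V : Set M} {φ : M → ℝ}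

theorem exists_toRing_eq (g : smoothRing V) : ∃ (φ : M → ℝ) (hφ : SmoothFunOn φ V),
    hφ.toRing = g := by
  obtain ⟨_, φ, hφ, rfl⟩ := g
  exact ⟨φ, hφ, rfl⟩

/-- A function on `M`, smooth on `V`, that represents an element of `smoothRing V`. -/
def smoothRep (g : smoothRing V) : M → ℝ := (exists_toRing_eq g).choose

theorem smoothFunOn_smoothRep (g : smoothRing V) : SmoothFunOn (smoothRep g) V :=
  (exists_toRing_eq g).choose_spec.choose

theorem domRestrict_smoothRep (g : smoothRing V) : V.domRestrict (smoothRep g) = g :=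
  congrArg Subtype.val (exists_toRing_eq g).choose_spec.choose_spec

theorem fieldDeriv_eq_of_domRestrict_eq (hV : IsOpen V) {χ : M → ℝ}
    (h : V.domRestrict φ = V.domRestrict χ) {q : M} (hq : q ∈ V) :
    fieldDeriv X φ q = fieldDeriv X χ q := by
  refine fieldDeriv_congr ?_
  filter_upwards [hV.mem_nhds hq] with p hp
  exact congrFun h ⟨p, hp⟩

variable [IsManifold (𝓡 3) ∞ M]

/-- A smooth vector field on `V`, as a derivation of the ring of smooth functions on `V`. -/
def fieldDerivation (hV : IsOpen V) (hX : SmoothFieldOn X V) :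
    Derivation ℝ (smoothRing V) (smoothRing V) :=
  Derivation.mk'
    { toFun := fun g => ((smoothFunOn_smoothRep g).fieldDeriv hV hX).toRing
      map_add' := by
        intro g g'
        ext ⟨q, hq⟩
        change fieldDeriv X _ q = fieldDeriv X _ q + fieldDeriv X _ q
        rw [← fieldDeriv_add ((smoothFunOn_smoothRep g).mdifferentiableAt hV hq)
          ((smoothFunOn_smoothRep g').mdifferentiableAt hV hq)]
        refine fieldDeriv_eq_of_domRestrict_eq hV ?_ hq
        rw [domRestrict_smoothRep]
        change (g : V → ℝ) + g' = V.domRestrict (smoothRep g) + V.domRestrict (smoothRep g')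
        rw [domRestrict_smoothRep, domRestrict_smoothRep]
      map_smul' := by
        intro r g
        ext ⟨q, hq⟩
        have hc : MDifferentiableAt (𝓡 3) 𝓘(ℝ, ℝ) (fun _ : M => r) q := mdifferentiableAt_const
        have := fieldDeriv_mul (X := X) hc ((smoothFunOn_smoothRep g).mdifferentiableAt hV hq)
        rw [fieldDeriv_const, mul_zero, add_zero] at this
        change fieldDeriv X _ q = r * fieldDeriv X _ q
        rw [← this]
        refine fieldDeriv_eq_of_domRestrict_eq hV ?_ hq
        rw [domRestrict_smoothRep]
        change r • (g : V → ℝ) = r • V.domRestrict (smoothRep g)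
        rw [domRestrict_smoothRep] }
    (by
      intro g g'
      ext ⟨q, hq⟩
      have := fieldDeriv_mul (X := X) ((smoothFunOn_smoothRep g).mdifferentiableAt hV hq)
        ((smoothFunOn_smoothRep g').mdifferentiableAt hV hq)
      change fieldDeriv X _ q = (g : V → ℝ) ⟨q, hq⟩ * fieldDeriv X _ q +
        (g' : V → ℝ) ⟨q, hq⟩ * fieldDeriv X _ q
      rw [← domRestrict_smoothRep g, ← domRestrict_smoothRep g']
      refine Eq.trans (fieldDeriv_eq_of_domRestrict_eq hV ?_ hq) this
      rw [domRestrict_smoothRep]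
      change (g : V → ℝ) * g' = V.domRestrict (smoothRep g) * V.domRestrict (smoothRep g')
      rw [domRestrict_smoothRep, domRestrict_smoothRep])

theorem fieldDerivation_toRing (hV : IsOpen V) (hX : SmoothFieldOn X V) (hφ : SmoothFunOn φ V) :
    fieldDerivation hV hX hφ.toRing = (hφ.fieldDeriv hV hX).toRing := by
  ext ⟨q, hq⟩
  exact fieldDeriv_eq_of_domRestrict_eq hV (domRestrict_smoothRep _) hq

end SmoothRing

/-! ### Frames with prescribed structure equations -/

section StructureFrame

variable {M : Type*} [TopologicalSpace M] [ChartedSpace E3 M] [IsManifold (𝓡 3) ∞ M]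

open VectorField

/-- A frame of smooth vector fields on `V` with
`[X₂, X₁] = X₀ + β X₂`, `[X₁, X₀] = p X₂`, `[X₂, X₀] = 0`. -/
structure IsStructureFrame (X : Fin 3 → VField M) (V : Set M) (β p : ℝ) : Prop where
  smooth : ∀ i, SmoothFieldOn (X i) V
  linearIndependent : ∀ q ∈ V, LinearIndependent ℝ (fun i => X i q)
  bracket21 : ∀ q ∈ V, mlieBracket (𝓡 3) (X 2) (X 1) q = X 0 q + β • X 2 q
  bracket10 : ∀ q ∈ V, mlieBracket (𝓡 3) (X 1) (X 0) q = p • X 2 q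
  bracket20 : ∀ q ∈ V, mlieBracket (𝓡 3) (X 2) (X 0) q = 0

variable {X : Fin 3 → VField M} {U V : Set M} {β p : ℝ}

theorem IsStructureFrame.mono (h : IsStructureFrame X U β p) (hVU : V ⊆ U) :
    IsStructureFrame X V β p :=
  ⟨fun i => (h.smooth i).mono hVU, fun q hq => h.linearIndependent q (hVU hq),
    fun q hq => h.bracket21 q (hVU hq), fun q hq => h.bracket10 q (hVU hq),
    fun q hq => h.bracket20 q (hVU hq)⟩

theorem IsStructureFrame.isStructureTriple (h : IsStructureFrame X V β p) (hV : IsOpen V) :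
    IsStructureTriple (fieldDerivation hV (h.smooth 0)) (fieldDerivation hV (h.smooth 1))
      (fieldDerivation hV (h.smooth 2)) (algebraMap ℝ (smoothRing V) β) (algebraMap ℝ _ p) := by
  constructor
  · intro g
    obtain ⟨φ, hφ, rfl⟩ := exists_toRing_eq g
    simp only [fieldDerivation_toRing]
    ext ⟨q, hq⟩
    refine (fieldDeriv_comm hV (h.smooth 2) (h.smooth 1) hφ hq).trans ?_
    change mfderiv (𝓡 3) 𝓘(ℝ, ℝ) φ q _ = mfderiv (𝓡 3) 𝓘(ℝ, ℝ) φ q _ +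
      β • mfderiv (𝓡 3) 𝓘(ℝ, ℝ) φ q _
    rw [h.bracket21 q hq, map_add, map_smul]
  · intro g
    obtain ⟨φ, hφ, rfl⟩ := exists_toRing_eq g
    simp only [fieldDerivation_toRing]
    ext ⟨q, hq⟩
    refine (fieldDeriv_comm hV (h.smooth 1) (h.smooth 0) hφ hq).trans ?_
    change mfderiv (𝓡 3) 𝓘(ℝ, ℝ) φ q _ = p • mfderiv (𝓡 3) 𝓘(ℝ, ℝ) φ q _
    rw [h.bracket10 q hq, map_smul]
  · intro g
    obtain ⟨φ, hφ, rfl⟩ := exists_toRing_eq g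
    simp only [fieldDerivation_toRing]
    ext ⟨q, hq⟩
    refine sub_eq_zero.1 ((fieldDeriv_comm hV (h.smooth 2) (h.smooth 0) hφ hq).trans ?_)
    change mfderiv (𝓡 3) 𝓘(ℝ, ℝ) φ q _ = 0
    rw [h.bracket20 q hq, map_zero]
  all_goals simp

/-- If the map `(u, v, w)` maps the planes spanned by `X₁, X₂` to the Heisenberg distribution, and
is conformal with factor `e^{2φ}` there, then the structure constants satisfy
`p = 0` or `p = (2/9) β²`. -/
theorem IsStructureFrame.obstruction (h : IsStructureFrame X V β p) (hV : IsOpen V)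
    (hne : V.Nonempty) {u v w φ : M → ℝ} (hu : SmoothFunOn u V) (hv : SmoothFunOn v V)
    (hw : SmoothFunOn w V) (hφ : SmoothFunOn φ V)
    (hcontact : ∀ q ∈ V, ∀ i ≠ 0, 2 * fieldDeriv (X i) w q =
      u q * fieldDeriv (X i) v q - v q * fieldDeriv (X i) u q)
    (hconf : ∀ q ∈ V, ∀ i ≠ 0, fieldDeriv (X i) u q * fieldDeriv (X i) u q +
      fieldDeriv (X i) v q * fieldDeriv (X i) v q = Real.exp (2 * φ q))
    (horth : ∀ q ∈ V, fieldDeriv (X 1) u q * fieldDeriv (X 2) u q +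
      fieldDeriv (X 1) v q * fieldDeriv (X 2) v q = 0) :
    p * (9 * p - 2 * β ^ 2) = 0 := by
  have hr : SmoothFunOn (fun q => Real.exp (2 * φ q)) V :=
    hφ.real_comp (f := fun t => Real.exp (2 * t)) (by fun_prop)
  have hr' : SmoothFunOn (fun q => Real.exp (-(2 * φ q))) V :=
    hφ.real_comp (f := fun t => Real.exp (-(2 * t))) (by fun_prop)
  have hDr : ∀ i, fieldDerivation hV (h.smooth i) hr.toRing =
      2 * hr.toRing * fieldDerivation hV (h.smooth i) hφ.toRing := by
    intro i
    simp only [fieldDerivation_toRing]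
    ext ⟨q, hq⟩
    have hd : HasDerivAt (fun t => Real.exp (2 * t)) (2 * Real.exp (2 * φ q)) (φ q) := by
      have := ((hasDerivAt_id (φ q)).const_mul 2).exp
      simpa [mul_comm] using this
    exact fieldDeriv_comp hd (hφ.mdifferentiableAt hV hq)
  have hunit : IsUnit hr.toRing := by
    refine IsUnit.of_mul_eq_one hr'.toRing ?_
    ext ⟨q, hq⟩
    change Real.exp _ * Real.exp _ = 1
    rw [← Real.exp_add, add_neg_cancel, Real.exp_zero]
  have key := (h.isStructureTriple hV).isometry_obstruction (u := hu.toRing) (v := hv.toRing)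
    (w := hw.toRing) (φ := hφ.toRing) hunit
    (by
      simp only [fieldDerivation_toRing]
      ext ⟨q, hq⟩
      exact hcontact q hq 1 (by decide))
    (by
      simp only [fieldDerivation_toRing]
      ext ⟨q, hq⟩
      exact hcontact q hq 2 (by decide))
    (by
      simp only [fieldDerivation_toRing]
      ext ⟨q, hq⟩
      exact hconf q hq 1 (by decide))
    (by
      simp only [fieldDerivation_toRing]
      ext ⟨q, hq⟩
      exact hconf q hq 2 (by decide))
    (by
      simp only [fieldDerivation_toRing]
      ext ⟨q, hq⟩
      exact horth q hq)
    (hDr 0) (hDr 1) (hDr 2)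
  obtain ⟨q, hq⟩ := hne
  exact congrFun (congrArg Subtype.val key) ⟨q, hq⟩

end StructureFrame

/-! ### Construction of conformal maps to the Heisenberg group -/

section Coordinates

variable {M : Type*} [TopologicalSpace M] [ChartedSpace E3 M] {U : Set M} {q : M}

theorem fieldDeriv_coord {F : M → E3} (hF : MDifferentiableAt (𝓡 3) (𝓡 3) F q) (X : VField M)
    (i : Fin 3) :
    fieldDeriv X (fun p => F p i) q = (show E3 from mfderiv (𝓡 3) (𝓡 3) F q (X q)) i := by
  have hp : HasMFDerivAt (𝓡 3) 𝓘(ℝ, ℝ) (EuclideanSpace.proj i : E3 →L[ℝ] ℝ) (F q)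
      (EuclideanSpace.proj i : E3 →L[ℝ] ℝ) :=
    (EuclideanSpace.proj i : E3 →L[ℝ] ℝ).hasFDerivAt.hasMFDerivAt
  have := (hp.comp q hF.hasMFDerivAt).mfderiv
  rw [fieldDeriv]
  erw [this]
  rfl

theorem SmoothFunOn.coord {F : M → E3} (hF : ContMDiffOn (𝓡 3) (𝓡 3) ∞ F U) (i : Fin 3) :
    SmoothFunOn (fun p => F p i) U :=
  (EuclideanSpace.proj i : E3 →L[ℝ] ℝ).contMDiff.comp_contMDiffOn hF

theorem contMDiffOn_of_coord {F : M → E3} (hF : ∀ i, SmoothFunOn (fun p => F p i) U) :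
    ContMDiffOn (𝓡 3) (𝓡 3) ∞ F U := by
  have h : ContMDiffOn (𝓡 3) 𝓘(ℝ, Fin 3 → ℝ) ∞ (fun p i => F p i) U :=
    contMDiffOn_pi_space.2 hF
  exact (EuclideanSpace.equiv (Fin 3) ℝ).symm.contDiff.contMDiff.comp_contMDiffOn h

end Coordinates

section Sufficiency

variable {M : Type*} [TopologicalSpace M] [ChartedSpace E3 M] [IsManifold (𝓡 3) ∞ M]
  {X : Fin 3 → VField M} {U : Set M} {β p : ℝ}

open VectorField

/-- A one-form with values `a i` on the frame, closed in view of the structure equations, has a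
local primitive. -/
theorem IsStructureFrame.exists_primitive (h : IsStructureFrame X U β p) (hU : IsOpen U) {q : M}
    (hq : q ∈ U) {a : Fin 3 → M → ℝ} (ha : ∀ i, SmoothFunOn (a i) U)
    (h21 : ∀ q ∈ U, fieldDeriv (X 2) (a 1) q - fieldDeriv (X 1) (a 2) q = a 0 q + β * a 2 q)
    (h10 : ∀ q ∈ U, fieldDeriv (X 1) (a 0) q - fieldDeriv (X 0) (a 1) q = p * a 2 q)
    (h20 : ∀ q ∈ U, fieldDeriv (X 2) (a 0) q = fieldDeriv (X 0) (a 2) q) :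
    ∃ V ⊆ U, IsOpen V ∧ q ∈ V ∧ ∃ φ : M → ℝ, SmoothFunOn φ V ∧
      ∀ p ∈ V, ∀ i, fieldDeriv (X i) φ p = a i p := by
  refine exists_primitive_of_frame hU hq h.smooth h.linearIndependent ha ?_
  intro i j q hq
  have swap : ∀ i j, (∃ c : Fin 3 → ℝ, mlieBracket (𝓡 3) (X i) (X j) q = ∑ k, c k • X k q ∧
      fieldDeriv (X i) (a j) q - fieldDeriv (X j) (a i) q = ∑ k, c k * a k q) →
      ∃ c : Fin 3 → ℝ, mlieBracket (𝓡 3) (X j) (X i) q = ∑ k, c k • X k q ∧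
      fieldDeriv (X j) (a i) q - fieldDeriv (X i) (a j) q = ∑ k, c k * a k q := by
    rintro i j ⟨c, hc, hc'⟩
    refine ⟨-c, ?_, ?_⟩
    · rw [mlieBracket_swap_apply, hc, ← Finset.sum_neg_distrib]
      exact Finset.sum_congr rfl fun k _ => (neg_smul _ _).symm
    · rw [← neg_sub, hc', ← Finset.sum_neg_distrib]
      exact Finset.sum_congr rfl fun k _ => (neg_mul _ _).symm
  have diag : ∀ i, ∃ c : Fin 3 → ℝ, mlieBracket (𝓡 3) (X i) (X i) q = ∑ k, c k • X k q ∧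
      fieldDeriv (X i) (a i) q - fieldDeriv (X i) (a i) q = ∑ k, c k * a k q := fun i =>
    ⟨0, by simp, by simp⟩
  have e21 : ∃ c : Fin 3 → ℝ, mlieBracket (𝓡 3) (X 2) (X 1) q = ∑ k, c k • X k q ∧
      fieldDeriv (X 2) (a 1) q - fieldDeriv (X 1) (a 2) q = ∑ k, c k * a k q :=
    ⟨![1, 0, β], by simp [Fin.sum_univ_three, h.bracket21 q hq],
      by simp [Fin.sum_univ_three, h21 q hq]⟩
  have e10 : ∃ c : Fin 3 → ℝ, mlieBracket (𝓡 3) (X 1) (X 0) q = ∑ k, c k • X k q ∧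
      fieldDeriv (X 1) (a 0) q - fieldDeriv (X 0) (a 1) q = ∑ k, c k * a k q :=
    ⟨![0, 0, p], by simp [Fin.sum_univ_three, h.bracket10 q hq],
      by simp [Fin.sum_univ_three, h10 q hq]⟩
  have e20 : ∃ c : Fin 3 → ℝ, mlieBracket (𝓡 3) (X 2) (X 0) q = ∑ k, c k • X k q ∧
      fieldDeriv (X 2) (a 0) q - fieldDeriv (X 0) (a 2) q = ∑ k, c k * a k q :=
    ⟨0, by simp [h.bracket20 q hq], by simp [h20 q hq]⟩
  fin_cases i <;> fin_cases j
  exacts [diag 0, swap _ _ e10, swap _ _ e20, e10, diag 1, swap _ _ e21, e20, e21, diag 2]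

/-- The closed form `-(β/3) θ₁`, with `θ₁` dual to `X₁`, has local primitives. -/
theorem IsStructureFrame.exists_conformal_factor (h : IsStructureFrame X U β p) (hU : IsOpen U)
    {q : M} (hq : q ∈ U) :
    ∃ V ⊆ U, IsOpen V ∧ q ∈ V ∧ ∃ φ : M → ℝ, SmoothFunOn φ V ∧
      ∀ p ∈ V, fieldDeriv (X 1) φ p = -β / 3 ∧ fieldDeriv (X 2) φ p = 0 := by
  have hconst : ∀ i : Fin 3, ∀ r : ℝ, ∀ q, fieldDeriv (X i) (fun _ => r) q = 0 :=
    fun i r q => fieldDeriv_const r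
  obtain ⟨V, hVU, hV, hqV, φ, hφ, hder⟩ := h.exists_primitive hU hq
    (a := fun i _ => ![0, -β / 3, 0] i) (fun i => contMDiffOn_const)
    (fun q _ => by simp [hconst]) (fun q _ => by simp [hconst]) (fun q _ => by simp [hconst])
  exact ⟨V, hVU, hV, hqV, φ, hφ, fun p hp => ⟨hder p hp 1, hder p hp 2⟩⟩

/-- Coordinates `x, y, z` in which the rescaled frame `e^{-φ} X₁, e^{-φ} X₂` is the Heisenberg
frame. The derivatives along `X₀` are those forced by `[X₂, X₁] = X₀ + β X₂`; the prescribed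
derivatives of `x` form a closed form precisely because `[X₁, X₀] = (2/9) β² X₂`. -/
theorem IsStructureFrame.exists_heisenberg_coordinates
    (h : IsStructureFrame X U β (2 / 9 * β ^ 2)) (hU : IsOpen U) {q : M} (hq : q ∈ U) {φ : M → ℝ}
    (hφ : SmoothFunOn φ U) (h1 : ∀ p ∈ U, fieldDeriv (X 1) φ p = -β / 3)
    (h2 : ∀ p ∈ U, fieldDeriv (X 2) φ p = 0) :
    ∃ V ⊆ U, IsOpen V ∧ q ∈ V ∧ ∃ x y z : M → ℝ,
      SmoothFunOn x V ∧ SmoothFunOn y V ∧ SmoothFunOn z V ∧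
      (∀ p ∈ V, fieldDeriv (X 0) x p = -(2 * β / 3) * Real.exp (φ p) ∧
        fieldDeriv (X 1) x p = 0 ∧ fieldDeriv (X 2) x p = Real.exp (φ p)) ∧
      (∀ p ∈ V, fieldDeriv (X 0) y p = 0 ∧ fieldDeriv (X 1) y p = Real.exp (φ p) ∧
        fieldDeriv (X 2) y p = 0) ∧
      ∀ p ∈ V, fieldDeriv (X 0) z p = Real.exp (φ p) * (Real.exp (φ p) + β / 3 * y p) ∧
        fieldDeriv (X 1) z p = Real.exp (φ p) * (x p / 2) ∧
        fieldDeriv (X 2) z p = Real.exp (φ p) * (-(y p / 2)) := by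
  have hconst : ∀ i : Fin 3, ∀ r : ℝ, ∀ q, fieldDeriv (X i) (fun _ => r) q = 0 :=
    fun i r q => fieldDeriv_const r
  set E : M → ℝ := fun p => Real.exp (φ p) with hE
  have hEs : SmoothFunOn E U := hφ.real_comp Real.contDiff_exp
  have h0 : ∀ p ∈ U, fieldDeriv (X 0) φ p = 0 := by
    intro p hp
    have hb := fieldDeriv_comm hU (h.smooth 2) (h.smooth 1) hφ hp
    have e1 : fieldDeriv (X 2) (fieldDeriv (X 1) φ) p = 0 := by
      rw [← hconst 2 (-β / 3) p]
      refine fieldDeriv_congr ?_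
      filter_upwards [hU.mem_nhds hp] with r hr using h1 r hr
    have e2 : fieldDeriv (X 1) (fieldDeriv (X 2) φ) p = 0 := by
      rw [← hconst 1 0 p]
      refine fieldDeriv_congr ?_
      filter_upwards [hU.mem_nhds hp] with r hr using h2 r hr
    have e3 : fieldDeriv (mlieBracket (𝓡 3) (X 2) (X 1)) φ p =
        fieldDeriv (X 0) φ p + β * fieldDeriv (X 2) φ p := by
      change mfderiv (𝓡 3) 𝓘(ℝ, ℝ) φ p _ = mfderiv (𝓡 3) 𝓘(ℝ, ℝ) φ p _ +
        β • mfderiv (𝓡 3) 𝓘(ℝ, ℝ) φ p _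
      rw [h.bracket21 p hp, map_add, map_smul]
    rw [e1, e2, e3, h2 p hp] at hb
    linarith
  have hEd : ∀ i, ∀ p ∈ U, fieldDeriv (X i) E p = E p * fieldDeriv (X i) φ p := fun i p hp =>
    fieldDeriv_comp (Real.hasDerivAt_exp (φ p)) (hφ.mdifferentiableAt hU hp)
  have hcE : ∀ (c : ℝ) i, ∀ p ∈ U, fieldDeriv (X i) (fun p => c * E p) p =
      c * (E p * fieldDeriv (X i) φ p) := by
    intro c i p hp
    have hc : MDifferentiableAt (𝓡 3) 𝓘(ℝ, ℝ) (fun _ : M => c) p := mdifferentiableAt_const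
    rw [fieldDeriv_mul hc (hEs.mdifferentiableAt hU hp), hEd i p hp, hconst, mul_zero, add_zero]
  have hcEs : ∀ c : ℝ, SmoothFunOn (fun p => c * E p) U := fun c =>
    ContMDiffOn.mul contMDiffOn_const hEs
  obtain ⟨V₁, hV₁U, hV₁, hq₁, x, hx, hxd⟩ := h.exists_primitive hU hq
    (a := ![fun p => -(2 * β / 3) * E p, fun _ => 0, E])
    (by intro i; fin_cases i; exacts [hcEs _, contMDiffOn_const, hEs])
    (fun p hp => by
      change fieldDeriv _ (fun _ => (0 : ℝ)) p - fieldDeriv _ E p = -(2 * β / 3) * E p + β * E p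
      rw [hconst, hEd 1 p hp, h1 p hp]; ring)
    (fun p hp => by
      change fieldDeriv _ (fun p => -(2 * β / 3) * E p) p - fieldDeriv _ (fun _ => (0 : ℝ)) p =
        2 / 9 * β ^ 2 * E p
      rw [hconst, hcE _ 1 p hp, h1 p hp]; ring)
    (fun p hp => by
      change fieldDeriv _ (fun p => -(2 * β / 3) * E p) p = fieldDeriv _ E p
      rw [hcE _ 2 p hp, hEd 0 p hp, h2 p hp, h0 p hp]; ring)
  obtain ⟨V₂, hV₂U, hV₂, hq₂, y, hy, hyd⟩ := h.exists_primitive hU hq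
    (a := ![fun _ => 0, E, fun _ => 0])
    (by intro i; fin_cases i; exacts [contMDiffOn_const, hEs, contMDiffOn_const])
    (fun p hp => by
      change fieldDeriv _ E p - fieldDeriv _ (fun _ => (0 : ℝ)) p = 0 + β * 0
      rw [hconst, hEd 2 p hp, h2 p hp]; ring)
    (fun p hp => by
      change fieldDeriv _ (fun _ => (0 : ℝ)) p - fieldDeriv _ E p = 2 / 9 * β ^ 2 * 0
      rw [hconst, hEd 0 p hp, h0 p hp]; ring)
    (fun p hp => by
      change fieldDeriv _ (fun _ => (0 : ℝ)) p = fieldDeriv _ (fun _ => (0 : ℝ)) p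
      rw [hconst, hconst])
  set W := V₁ ∩ V₂ with hW
  have hWo : IsOpen W := hV₁.inter hV₂
  have hWU : W ⊆ U := Set.inter_subset_left.trans hV₁U
  have hxW : SmoothFunOn x W := ContMDiffOn.mono hx Set.inter_subset_left
  have hyW : SmoothFunOn y W := ContMDiffOn.mono hy Set.inter_subset_right
  have hEW : SmoothFunOn E W := ContMDiffOn.mono hEs hWU
  have hxd' : ∀ p ∈ W, fieldDeriv (X 0) x p = -(2 * β / 3) * E p ∧
        fieldDeriv (X 1) x p = 0 ∧ fieldDeriv (X 2) x p = E p := fun p hp =>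
    ⟨hxd p hp.1 0, hxd p hp.1 1, hxd p hp.1 2⟩
  have hyd' : ∀ p ∈ W, fieldDeriv (X 0) y p = 0 ∧ fieldDeriv (X 1) y p = E p ∧
      fieldDeriv (X 2) y p = 0 := fun p hp => ⟨hyd p hp.2 0, hyd p hp.2 1, hyd p hp.2 2⟩
  -- functions of the form `E (a E + b x + c y)`, in which the values on the frame are written
  have hs : ∀ a b c : ℝ, SmoothFunOn (fun p => E p * (a * E p + (b * x p + c * y p))) W :=
    fun a b c => ContMDiffOn.mul hEW ((contMDiffOn_const.mul hEW).add
      ((contMDiffOn_const.mul hxW).add (contMDiffOn_const.mul hyW)))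
  have hd : ∀ (a b c : ℝ) i, ∀ p ∈ W,
      fieldDeriv (X i) (fun p => E p * (a * E p + (b * x p + c * y p))) p =
      E p * (a * (E p * fieldDeriv (X i) φ p) +
        (b * fieldDeriv (X i) x p + c * fieldDeriv (X i) y p)) +
      (a * E p + (b * x p + c * y p)) * (E p * fieldDeriv (X i) φ p) := by
    intro a b c i p hp
    have mE := hEW.mdifferentiableAt hWo hp
    have mx := hxW.mdifferentiableAt hWo hp
    have my := hyW.mdifferentiableAt hWo hp
    have mc : ∀ c : ℝ, MDifferentiableAt (𝓡 3) 𝓘(ℝ, ℝ) (fun _ : M => c) p :=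
      fun c => mdifferentiableAt_const
    have mlin : ∀ {f : M → ℝ} (c : ℝ), MDifferentiableAt (𝓡 3) 𝓘(ℝ, ℝ) f p →
        MDifferentiableAt (𝓡 3) 𝓘(ℝ, ℝ) (fun r => c * f r) p := fun c hf => (mc c).mul hf
    have madd : ∀ {f g : M → ℝ}, MDifferentiableAt (𝓡 3) 𝓘(ℝ, ℝ) f p →
        MDifferentiableAt (𝓡 3) 𝓘(ℝ, ℝ) g p →
        MDifferentiableAt (𝓡 3) 𝓘(ℝ, ℝ) (fun r => f r + g r) p := fun hf hg => hf.add hg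
    rw [fieldDeriv_mul mE (madd (mlin a mE) (madd (mlin b mx) (mlin c my))),
      fieldDeriv_add (mlin a mE) (madd (mlin b mx) (mlin c my)),
      fieldDeriv_add (mlin b mx) (mlin c my), fieldDeriv_mul (mc a) mE, fieldDeriv_mul (mc b) mx,
      fieldDeriv_mul (mc c) my, hconst, hconst, hconst, hEd i p (hWU hp)]
    ring
  obtain ⟨V, hVW, hV, hqV, z, hz, hzd⟩ := (h.mono hWU).exists_primitive hWo ⟨hq₁, hq₂⟩
    (a := ![fun p => E p * (1 * E p + (0 * x p + β / 3 * y p)),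
      fun p => E p * (0 * E p + (1 / 2 * x p + 0 * y p)),
      fun p => E p * (0 * E p + (0 * x p + -1 / 2 * y p))])
    (by intro i; fin_cases i; exacts [hs _ _ _, hs _ _ _, hs _ _ _])
    (fun p hp => by
      change fieldDeriv _ (fun p => E p * (0 * E p + (1 / 2 * x p + 0 * y p))) p -
        fieldDeriv _ (fun p => E p * (0 * E p + (0 * x p + -1 / 2 * y p))) p =
        E p * (1 * E p + (0 * x p + β / 3 * y p)) +
        β * (E p * (0 * E p + (0 * x p + -1 / 2 * y p)))
      rw [hd _ _ _ 2 p hp, hd _ _ _ 1 p hp, h1 p (hWU hp), h2 p (hWU hp), (hxd' p hp).2.1,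
        (hxd' p hp).2.2, (hyd' p hp).2.1, (hyd' p hp).2.2]
      ring)
    (fun p hp => by
      change fieldDeriv _ (fun p => E p * (1 * E p + (0 * x p + β / 3 * y p))) p -
        fieldDeriv _ (fun p => E p * (0 * E p + (1 / 2 * x p + 0 * y p))) p =
        2 / 9 * β ^ 2 * (E p * (0 * E p + (0 * x p + -1 / 2 * y p)))
      rw [hd _ _ _ 1 p hp, hd _ _ _ 0 p hp, h1 p (hWU hp), h0 p (hWU hp), (hxd' p hp).2.1,
        (hxd' p hp).1, (hyd' p hp).2.1, (hyd' p hp).1]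
      ring)
    (fun p hp => by
      change fieldDeriv _ (fun p => E p * (1 * E p + (0 * x p + β / 3 * y p))) p =
        fieldDeriv _ (fun p => E p * (0 * E p + (0 * x p + -1 / 2 * y p))) p
      rw [hd _ _ _ 2 p hp, hd _ _ _ 0 p hp, h2 p (hWU hp), h0 p (hWU hp), (hxd' p hp).2.2,
        (hxd' p hp).1, (hyd' p hp).2.2, (hyd' p hp).1]
      ring)
  refine ⟨V, hVW.trans hWU, hV, hqV, x, y, z, ContMDiffOn.mono hxW hVW, ContMDiffOn.mono hyW hVW,
    hz, fun p hp => hxd' p (hVW hp), fun p hp => hyd' p (hVW hp), fun p hp => ⟨?_, ?_, ?_⟩⟩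
  · refine (hzd p hp 0).trans ?_
    change E p * (1 * E p + (0 * x p + β / 3 * y p)) = E p * (E p + β / 3 * y p)
    ring
  · refine (hzd p hp 1).trans ?_
    change E p * (0 * E p + (1 / 2 * x p + 0 * y p)) = E p * (x p / 2)
    ring
  · refine (hzd p hp 2).trans ?_
    change E p * (0 * E p + (0 * x p + -1 / 2 * y p)) = E p * (-(y p / 2))
    ring

end Sufficiency

section Admissible

variable {M : Type*} [TopologicalSpace M] [ChartedSpace E3 M] [IsManifold (𝓡 3) ∞ M]
  {X : Fin 3 → VField M} {U : Set M} {β p : ℝ}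

theorem IsOrthonormalPairAt.metric_eq {S : SubRiemannian M} {X Y : VField M} {q : M}
    (h : IsOrthonormalPairAt S.dist S.metric X Y q) {v w : S.dist q} {a b c d : ℝ}
    (hv : (v : TangentSpace (𝓡 3) q) = a • X q + b • Y q)
    (hw : (w : TangentSpace (𝓡 3) q) = c • X q + d • Y q) :
    S.metric q v w = a * c + b * d := by
  obtain ⟨-, hX, hY, hXX, hYY, hXY⟩ := h
  have hYX := (S.metric_symm q ⟨Y q, hY⟩ ⟨X q, hX⟩).trans hXY
  have hv' : v = a • (⟨X q, hX⟩ : S.dist q) + b • (⟨Y q, hY⟩ : S.dist q) := Subtype.ext hv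
  have hw' : w = c • (⟨X q, hX⟩ : S.dist q) + d • (⟨Y q, hY⟩ : S.dist q) := Subtype.ext hw
  rw [hv', hw']
  simp only [map_add, map_smul, LinearMap.add_apply, LinearMap.smul_apply, hXX, hYY, hXY, hYX,
    smul_eq_mul]
  ring

theorem IsOrthonormalPairAt.exists_coeff {S : SubRiemannian M} {X Y : VField M} {q : M}
    (h : IsOrthonormalPairAt S.dist S.metric X Y q) (v : S.dist q) :
    ∃ a b : ℝ, (v : TangentSpace (𝓡 3) q) = a • X q + b • Y q := by
  have hv : (v : TangentSpace (𝓡 3) q) ∈ Submodule.span ℝ {X q, Y q} := h.1.le v.2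
  obtain ⟨a, b, hab⟩ := Submodule.mem_span_pair.1 hv
  exact ⟨a, b, hab.symm⟩

namespace SubRiemannian

theorem isOrthonormalPairAt_heisenberg (q : E3) :
    IsOrthonormalPairAt heisenberg.dist heisenberg.metric heisField1 heisField2 q := by
  refine ⟨rfl, Submodule.subset_span (Set.mem_insert _ _),
    Submodule.subset_span (Set.mem_insert_of_mem _ rfl), ?_, ?_, ?_⟩
  · exact (by norm_num : (0 : ℝ) * 0 + 1 * 1 = 1)
  · exact (by norm_num : (1 : ℝ) * 1 + 0 * 0 = 1)
  · exact (by norm_num : (0 : ℝ) * 1 + 1 * 0 = 0)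

/-- The coordinates of `IsStructureFrame.exists_heisenberg_coordinates` are the components of a local
isometry of the rescaled structure to the Heisenberg group. -/
theorem isAdmissible_of_structureFrame (S : SubRiemannian M)
    (h : IsStructureFrame X U β (2 / 9 * β ^ 2)) (hU : IsOpen U)
    (horth : ∀ q ∈ U, IsOrthonormalPairAt S.dist S.metric (X 1) (X 2) q) {φ : M → ℝ}
    (hφ : SmoothFunOn φ U) (h1 : ∀ p ∈ U, fieldDeriv (X 1) φ p = -β / 3)
    (h2 : ∀ p ∈ U, fieldDeriv (X 2) φ p = 0) : S.IsAdmissible U φ := by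
  intro q hq
  obtain ⟨V, hVU, hV, hqV, x, y, z, hx, hy, hz, hxd, hyd, hzd⟩ :=
    h.exists_heisenberg_coordinates hU hq hφ h1 h2
  set F : M → E3 := fun p => !₂[x p, y p, z p] with hFdef
  have hF : ContMDiffOn (𝓡 3) (𝓡 3) ∞ F V := by
    refine contMDiffOn_of_coord fun i => ?_
    fin_cases i
    exacts [hx, hy, hz]
  have hmd : ∀ p ∈ V, MDifferentiableAt (𝓡 3) (𝓡 3) F p := fun p hp =>
    (hF.contMDiffAt (hV.mem_nhds hp)).mdifferentiableAt (by simp)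
  have hdF : ∀ p ∈ V, ∀ i, (show E3 from mfderiv (𝓡 3) (𝓡 3) F p (X i p)) =
      !₂[fieldDeriv (X i) x p, fieldDeriv (X i) y p, fieldDeriv (X i) z p] := by
    intro p hp i
    ext j
    rw [← fieldDeriv_coord (hmd p hp) (X i) j]
    fin_cases j <;> rfl
  have hd1 : ∀ p ∈ V, mfderiv (𝓡 3) (𝓡 3) F p (X 1 p) = Real.exp (φ p) • heisField1 (F p) := by
    intro p hp
    refine (hdF p hp 1).trans ?_
    rw [(hxd p hp).2.1, (hyd p hp).2.1, (hzd p hp).2.1]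
    change (_ : E3) = Real.exp (φ p) • (!₂[0, 1, F p 0 / 2] : E3)
    ext j
    fin_cases j <;> simp [hFdef]
  have hd2 : ∀ p ∈ V, mfderiv (𝓡 3) (𝓡 3) F p (X 2 p) = Real.exp (φ p) • heisField2 (F p) := by
    intro p hp
    refine (hdF p hp 2).trans ?_
    rw [(hxd p hp).2.2, (hyd p hp).2.2, (hzd p hp).2.2]
    change (_ : E3) = Real.exp (φ p) • (!₂[1, 0, -(F p 1 / 2)] : E3)
    ext j
    fin_cases j <;> simp [hFdef]
  have hinj : ∀ p ∈ V, Function.Injective (mfderiv (𝓡 3) (𝓡 3) F p) := by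
    intro p hp
    rw [injective_iff_map_eq_zero]
    intro v hv
    have hbasis := (h.linearIndependent p (hVU hp)).span_eq_top_of_card_eq_finrank
      (by rw [Fintype.card_fin]; exact (finrank_euclideanSpace_fin (𝕜 := ℝ) (n := 3)).symm)
    have hvs : v ∈ Submodule.span ℝ (Set.range fun i => X i p) := by rw [hbasis]; trivial
    obtain ⟨c, rfl⟩ := (Submodule.mem_span_range_iff_exists_fun ℝ).1 hvs
    rw [Fin.sum_univ_three, map_add, map_add, map_smul, map_smul, map_smul] at hv
    have hv' : c 0 • (!₂[fieldDeriv (X 0) x p, fieldDeriv (X 0) y p, fieldDeriv (X 0) z p] : E3) +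
        c 1 • !₂[fieldDeriv (X 1) x p, fieldDeriv (X 1) y p, fieldDeriv (X 1) z p] +
        c 2 • !₂[fieldDeriv (X 2) x p, fieldDeriv (X 2) y p, fieldDeriv (X 2) z p] = 0 := by
      rw [← hdF p hp 0, ← hdF p hp 1, ← hdF p hp 2]
      exact hv
    have hE := Real.exp_ne_zero (φ p)
    rw [(hxd p hp).1, (hxd p hp).2.1, (hxd p hp).2.2, (hyd p hp).1, (hyd p hp).2.1,
      (hyd p hp).2.2, (hzd p hp).1, (hzd p hp).2.1, (hzd p hp).2.2] at hv'
    have e0 := congrArg (fun w : E3 => w 0) hv'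
    have e1 := congrArg (fun w : E3 => w 1) hv'
    have e2 := congrArg (fun w : E3 => w 2) hv'
    simp at e0 e1 e2
    rw [e1] at e2
    have hc0 : c 0 = 0 := by
      have : c 0 * Real.exp (φ p) ^ 2 = 0 := by linear_combination e2 + y p / 2 * e0
      exact (mul_eq_zero.1 this).resolve_right (pow_ne_zero 2 hE)
    rw [hc0] at e0
    have hc2 : c 2 = 0 := by simpa [hE] using e0
    simp [Fin.sum_univ_three, hc0, e1, hc2]
  obtain ⟨Φ, hqΦ, hΦV, hΦF, hΦs, hΦs'⟩ :=
    exists_openPartialHomeomorph_of_injective_mfderiv hV hqV hF hinj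
  refine ⟨Φ, hqΦ, hΦV.trans hVU, hΦs, hΦs', fun p hp => ?_⟩
  have hpV := hΦV hp
  have hev : Φ =ᶠ[nhds p] F := by
    filter_upwards [Φ.open_source.mem_nhds hp] with r hr using hΦF r hr
  have hE := Real.exp_ne_zero (φ p)
  have hd1' : mfderiv (𝓡 3) (𝓡 3) Φ p (X 1 p) = Real.exp (φ p) • heisField1 (Φ p) := by
    rw [hev.mfderiv_eq, hΦF p hp]
    exact hd1 p hpV
  have hd2' : mfderiv (𝓡 3) (𝓡 3) Φ p (X 2 p) = Real.exp (φ p) • heisField2 (Φ p) := by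
    rw [hev.mfderiv_eq, hΦF p hp]
    exact hd2 p hpV
  have ho := horth p (hVU hpV)
  constructor
  · rw [ho.1, Submodule.map_span, Set.image_pair]
    change Submodule.span ℝ {heisField1 (Φ p), heisField2 (Φ p)} =
      Submodule.span ℝ {mfderiv (𝓡 3) (𝓡 3) Φ p (X 1 p), mfderiv (𝓡 3) (𝓡 3) Φ p (X 2 p)}
    rw [hd1', hd2', Submodule.span_insert, Submodule.span_insert,
      Submodule.span_singleton_smul_eq hE.isUnit, Submodule.span_singleton_smul_eq hE.isUnit]
  · intro v w v' w' hv hw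
    obtain ⟨a, b, hab⟩ := ho.exists_coeff v
    obtain ⟨c, d, hcd⟩ := ho.exists_coeff w
    rw [ho.metric_eq hab hcd]
    have key : ∀ a b : ℝ, mfderiv (𝓡 3) (𝓡 3) Φ p (a • X 1 p + b • X 2 p) =
        (a * Real.exp (φ p)) • heisField1 (Φ p) + (b * Real.exp (φ p)) • heisField2 (Φ p) := by
      intro a b
      rw [map_add, map_smul, map_smul, hd1', hd2', smul_smul, smul_smul]
    rw [hab, key] at hv
    rw [hcd, key] at hw
    rw [(isOrthonormalPairAt_heisenberg (Φ p)).metric_eq hv hw, two_mul, Real.exp_add]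
    ring

end SubRiemannian

end Admissible

/-! ### Lie algebras with a canonical basis -/

section LieAlgebra

variable {L : Type*} [LieRing L] [LieAlgebra ℝ L]

theorem Module.Basis.smul_add_smul_eq_zero {f : Module.Basis (Fin 3) ℝ L} {i j : Fin 3}
    (hij : i ≠ j) {a b : ℝ} (h : a • f i + b • f j = 0) : a = 0 ∧ b = 0 := by
  have := congrArg f.repr h
  constructor
  · simpa [hij, hij.symm] using DFunLike.congr_fun this i
  · simpa [hij, hij.symm] using DFunLike.congr_fun this j

/-- The Jacobi identity for a canonical basis. -/
theorem canonical_jacobi (f : Module.Basis (Fin 3) ℝ L) {α β p q : ℝ}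
    (h21 : ⁅f 2, f 1⁆ = f 0 + α • f 1 + β • f 2) (h10 : ⁅f 1, f 0⁆ = p • f 2)
    (h20 : ⁅f 2, f 0⁆ = q • f 1) : α * p = 0 ∧ β * q = 0 := by
  have h := leibniz_lie (f 2) (f 1) (f 0)
  rw [h21, h10, h20] at h
  simp only [add_lie, smul_lie, lie_smul, lie_self, smul_zero, h10, h20, zero_add, add_zero,
    smul_smul] at h
  exact f.smul_add_smul_eq_zero (by decide) h.symm

/-- A canonical basis with `c₁₂¹ = c₁₂² = 0` exists only on unimodular algebras. -/
theorem trace_ad_eq_zero_of_canonical (f : Module.Basis (Fin 3) ℝ L) {p q : ℝ}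
    (h21 : ⁅f 2, f 1⁆ = f 0) (h10 : ⁅f 1, f 0⁆ = p • f 2) (h20 : ⁅f 2, f 0⁆ = q • f 1) (m : L) :
    LinearMap.trace ℝ L (LieAlgebra.ad ℝ L m) = 0 := by
  have h12 : ⁅f 1, f 2⁆ = -f 0 := by rw [← lie_skew, h21]
  have h01 : ⁅f 0, f 1⁆ = -(p • f 2) := by rw [← lie_skew, h10]
  have h02 : ⁅f 0, f 2⁆ = -(q • f 1) := by rw [← lie_skew, h20]
  have h : LinearMap.trace ℝ L ∘ₗ (LieAlgebra.ad ℝ L : L →ₗ[ℝ] Module.End ℝ L) = 0 := by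
    refine f.ext fun i => ?_
    change LinearMap.trace ℝ L (LieAlgebra.ad ℝ L (f i)) = 0
    rw [LinearMap.trace_eq_matrix_trace ℝ f, Matrix.trace, Fin.sum_univ_three]
    simp only [Matrix.diag_apply, LinearMap.toMatrix_apply, LieAlgebra.ad_apply]
    fin_cases i <;> simp [h12, h01, h02, h21, h10, h20]
  exact LinearMap.congr_fun h m

/-- In an adapted basis the operator `ad f₀` is trace-free on the plane. -/
theorem adapted_jacobi (f : Module.Basis (Fin 3) ℝ L) {α β A B C D : ℝ}
    (h21 : ⁅f 2, f 1⁆ = f 0 + α • f 1 + β • f 2) (h10 : ⁅f 1, f 0⁆ = A • f 1 + B • f 2)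
    (h20 : ⁅f 2, f 0⁆ = C • f 1 + D • f 2) : D = -A := by
  have h12 : ⁅f 1, f 2⁆ = -(f 0 + α • f 1 + β • f 2) := by rw [← lie_skew, h21]
  have h := leibniz_lie (f 2) (f 1) (f 0)
  rw [h21, h10, h20] at h
  simp only [add_lie, lie_add, smul_lie, lie_smul, lie_self, smul_zero, h10, h20, h21, h12,
    zero_add, add_zero] at h
  have := DFunLike.congr_fun (congrArg f.repr h) 0
  simp at this
  linarith

/-- An orthogonal change of the frame `f₁, f₂` of determinant `σ`, with `f₀` multiplied
by `σ`. -/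
theorem exists_basis_of_orthogonal (f : Module.Basis (Fin 3) ℝ L) {σ a b c d : ℝ}
    (hσ : σ * σ = 1) (hab : a * a + b * b = 1) (hcd : c * c + d * d = 1)
    (hac : a * c + b * d = 0) :
    ∃ g : Module.Basis (Fin 3) ℝ L, g 0 = σ • f 0 ∧ g 1 = a • f 1 + b • f 2 ∧
      g 2 = c • f 1 + d • f 2 := by
  have hli : LinearIndependent ℝ ![σ • f 0, a • f 1 + b • f 2, c • f 1 + d • f 2] := by
    rw [Fintype.linearIndependent_iff]
    intro x hx
    rw [Fin.sum_univ_three] at hx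
    have h := congrArg f.repr hx
    have h0 := DFunLike.congr_fun h 0
    have h1 := DFunLike.congr_fun h 1
    have h2 := DFunLike.congr_fun h 2
    simp at h0 h1 h2
    have hx1 : x 1 = 0 := by linear_combination a * h1 + b * h2 - x 1 * hab - x 2 * hac
    have hx2 : x 2 = 0 := by linear_combination c * h1 + d * h2 - x 1 * hac - x 2 * hcd
    have hx0 : x 0 = 0 := by
      rcases h0 with h0 | h0
      · exact h0
      · rw [h0] at hσ; norm_num at hσ
    intro i
    fin_cases i
    exacts [hx0, hx1, hx2]
  have : FiniteDimensional ℝ L := f.finiteDimensional_of_finite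
  refine ⟨basisOfLinearIndependentOfCardEqFinrank hli (Module.finrank_eq_card_basis f).symm,
    ?_, ?_, ?_⟩ <;> simp

/-- Half the argument of `K - i A` is the angle of a rotation that kills the diagonal of the
trace-free symmetric matrix with diagonal entry `A` and off-diagonal entry `K`. -/
theorem exists_rotation {A K : ℝ} (h : A * A + K * K ≠ 0) :
    ∃ c s : ℝ, c * c + s * s = 1 ∧ (c * c - s * s) * A + 2 * c * s * K = 0 ∧
      (c * c - s * s) * K - 2 * c * s * A ≠ 0 := by
  set z : ℂ := ⟨K, -A⟩ with hz
  have hz0 : z ≠ 0 := by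
    intro h0
    apply h
    have h1 : K = 0 := congrArg Complex.re h0
    have h2 : -A = 0 := congrArg Complex.im h0
    rw [neg_eq_zero.1 h2, h1]; ring
  have hn : ‖z‖ ≠ 0 := norm_ne_zero_iff.2 hz0
  have hc : ‖z‖ * Real.cos (2 * (z.arg / 2)) = K := by
    rw [mul_div_cancel₀ _ two_ne_zero]; exact Complex.norm_mul_cos_arg z
  have hs : ‖z‖ * Real.sin (2 * (z.arg / 2)) = -A := by
    rw [mul_div_cancel₀ _ two_ne_zero]; exact Complex.norm_mul_sin_arg z
  set c := Real.cos (z.arg / 2)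
  set s := Real.sin (z.arg / 2)
  have hcs : c * c + s * s = 1 := by
    have := Real.sin_sq_add_cos_sq (z.arg / 2)
    linear_combination this
  rw [Real.cos_two_mul] at hc
  rw [Real.sin_two_mul] at hs
  refine ⟨c, s, hcs, ?_, fun h0 => h ?_⟩
  · refine (mul_eq_zero.1 (?_ : ‖z‖ * _ = 0)).resolve_left hn
    linear_combination A * hc + K * hs - ‖z‖ * A * hcs
  · linear_combination ‖z‖ * h0 - K * hc + A * hs + ‖z‖ * K * hcs

end LieAlgebra

/-! ### Left-invariant frames -/

section Group

open VectorField

variable {G : Type*} [TopologicalSpace G] [ChartedSpace E3 G] [Group G] [LieGroup (𝓡 3) ∞ G]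

theorem mlieBracket_mulInvariantVectorField (v w : GroupLieAlgebra (𝓡 3) G) :
    mlieBracket (𝓡 3) (mulInvariantVectorField v) (mulInvariantVectorField w) =
      mulInvariantVectorField (I := 𝓡 3) ⁅v, w⁆ :=
  (mulInvariantVector_mlieBracket v w).symm

/-- A left-invariant field is determined by its value at any point. -/
theorem mulInvariantVectorField_injective (g : G) :
    Function.Injective (fun v : GroupLieAlgebra (𝓡 3) G =>
      (mulInvariantVectorField v : VField G) g) := by
  have hd : ∀ a b : G, MDifferentiableAt (𝓡 3) (𝓡 3) (fun x : G => a * x) b := fun a b =>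
    (contMDiff_mul_left (I := 𝓡 3) (n := ∞) (a := a)).contMDiffAt.mdifferentiableAt (by simp)
  have h := mfderiv_comp (1 : G) (hd g⁻¹ (g * 1)) (hd g 1)
  have hid : ((fun x : G => g⁻¹ * x) ∘ fun x => g * x) = id := by ext x; simp
  rw [hid, mfderiv_id] at h
  intro v w hvw
  have hv := DFunLike.congr_fun h v
  have hw := DFunLike.congr_fun h w
  refine hv.trans (Eq.trans ?_ hw.symm)
  exact congrArg (mfderiv (𝓡 3) (𝓡 3) (fun x : G => g⁻¹ * x) (g * 1)) hvw

namespace LieFrame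

variable (f : LieFrame G)

theorem linearIndependent_field (g : G) : LinearIndependent ℝ (fun i => f.field i g) := by
  let T : GroupLieAlgebra (𝓡 3) G →ₗ[ℝ] TangentSpace (𝓡 3) g :=
    (mfderiv (𝓡 3) (𝓡 3) (fun x : G => g * x) 1).toLinearMap
  have hT : LinearMap.ker T = ⊥ := by
    rw [LinearMap.ker_eq_bot]
    exact mulInvariantVectorField_injective g
  exact f.linearIndependent.map' T hT

theorem isStructureFrame {β p : ℝ} (hs : ∀ i, SmoothFieldOn (f.field i) Set.univ)
    (h21 : ⁅f 2, f 1⁆ = f 0 + β • f 2) (h10 : ⁅f 1, f 0⁆ = p • f 2) (h20 : ⁅f 2, f 0⁆ = 0) :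
    IsStructureFrame f.field Set.univ β p := by
  refine ⟨hs, fun q _ => f.linearIndependent_field q, fun q _ => ?_, fun q _ => ?_, fun q _ => ?_⟩
  · rw [field, field, mlieBracket_mulInvariantVectorField, h21, mulInvariantVectorField_add,
      mulInvariantVectorField_smul]
    rfl
  · rw [field, field, mlieBracket_mulInvariantVectorField, h10, mulInvariantVectorField_smul]
    rfl
  · rw [field, field, mlieBracket_mulInvariantVectorField, h20]
    exact map_zero (mfderiv (𝓡 3) (𝓡 3) (fun x : G => q * x) 1)

end LieFrame

namespace SubRiemannian

variable {S : SubRiemannian G} {f g : LieFrame G}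

theorem IsAdaptedLieFrame.smooth (h : S.IsAdaptedLieFrame f) (i : Fin 3) :
    SmoothFieldOn (f.field i) Set.univ := by
  fin_cases i
  exacts [h.1, h.2.1, h.2.2.1]

/-- The form dual to `f₀` reads off the `f₀`-component. -/
theorem IsAdaptedLieFrame.form_apply {α : OneForm G} (hα0 : ∀ q, α q (f.field 0 q) = 1)
    (hα1 : ∀ q, α q (f.field 1 q) = 0) (hα2 : ∀ q, α q (f.field 2 q) = 0)
    (v : GroupLieAlgebra (𝓡 3) G) (q : G) :
    α q ((mulInvariantVectorField v : VField G) q) = f.repr v 0 := by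
  conv_lhs => rw [← f.sum_repr v, Fin.sum_univ_three, mulInvariantVectorField_add,
    mulInvariantVectorField_add, mulInvariantVectorField_smul, mulInvariantVectorField_smul,
    mulInvariantVectorField_smul]
  change α q (f.repr v 0 • f.field 0 q + f.repr v 1 • f.field 1 q + f.repr v 2 • f.field 2 q) = _
  rw [map_add, map_add, map_smul, map_smul, map_smul, hα0, hα1, hα2]
  simp

/-- On left-invariant fields on which `α` is constant, `dα(X, Y) = - α([X, Y])`. -/
theorem extDerivForm_mulInvariantVectorField {α : OneForm G} {v w : GroupLieAlgebra (𝓡 3) G}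
    {a b : ℝ} (hv : ∀ q, α q ((mulInvariantVectorField v : VField G) q) = a)
    (hw : ∀ q, α q ((mulInvariantVectorField w : VField G) q) = b) (q : G) :
    extDerivForm α (mulInvariantVectorField v) (mulInvariantVectorField w) q =
      -α q ((mulInvariantVectorField ⁅v, w⁆ : VField G) q) := by
  rw [extDerivForm, mlieBracket_mulInvariantVectorField]
  simp only [hv, hw, fieldDeriv_const]
  ring

/-- The `f₀`-components of the brackets of an adapted frame: they are values of `-dα` for the contact
form `α`, with `dα(f₁, f₂) = 1` and `dα(f₀, ·) = 0`. -/
theorem IsAdaptedLieFrame.repr_bracket (h : S.IsAdaptedLieFrame f) :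
    f.repr ⁅f 2, f 1⁆ 0 = 1 ∧ f.repr ⁅f 1, f 0⁆ 0 = 0 ∧ f.repr ⁅f 2, f 0⁆ 0 = 0 := by
  obtain ⟨-, s1, s2, ho, α, -, hker, h12, h0, hReeb⟩ := h
  have hα1 : ∀ q, α q (f.field 1 q) = 0 := fun q => (hker q _).1 (ho q).2.1
  have hα2 : ∀ q, α q (f.field 2 q) = 0 := fun q => (hker q _).1 (ho q).2.2.1
  have key := IsAdaptedLieFrame.form_apply h0 hα1 hα2
  have e12 := h12 1
  have e1 := hReeb _ s1 1
  have e2 := hReeb _ s2 1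
  rw [LieFrame.field, LieFrame.field, extDerivForm_mulInvariantVectorField hα1 hα2, key] at e12
  rw [LieFrame.field, LieFrame.field, extDerivForm_mulInvariantVectorField h0 hα1, key] at e1
  rw [LieFrame.field, LieFrame.field, extDerivForm_mulInvariantVectorField h0 hα2, key] at e2
  rw [← lie_skew (f 2) (f 1), ← lie_skew (f 1) (f 0), ← lie_skew (f 2) (f 0)]
  simp only [map_neg, Finsupp.neg_apply]
  exact ⟨e12, by rw [e1], by rw [e2]⟩

/-- An orthogonal change of `f₁, f₂` of determinant `σ`, together with `f₀ ↦ σ f₀`, maps adapted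
frames to adapted frames. -/
theorem IsAdaptedLieFrame.of_orthogonal (h : S.IsAdaptedLieFrame f) {σ a b c d : ℝ}
    (hσ : σ * σ = 1) (hab : a * a + b * b = 1) (hcd : c * c + d * d = 1)
    (hac : a * c + b * d = 0) (hdet : a * d - b * c = σ) (h0 : g 0 = σ • f 0)
    (h1 : g 1 = a • f 1 + b • f 2) (h2 : g 2 = c • f 1 + d • f 2) : S.IsAdaptedLieFrame g := by
  have hg0 : g.field 0 = σ • f.field 0 := by
    rw [LieFrame.field, h0, mulInvariantVectorField_smul]; rfl
  have hg1 : g.field 1 = a • f.field 1 + b • f.field 2 := by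
    rw [LieFrame.field, h1, mulInvariantVectorField_add, mulInvariantVectorField_smul,
      mulInvariantVectorField_smul]; rfl
  have hg2 : g.field 2 = c • f.field 1 + d • f.field 2 := by
    rw [LieFrame.field, h2, mulInvariantVectorField_add, mulInvariantVectorField_smul,
      mulInvariantVectorField_smul]; rfl
  have hsm : ∀ {X Y : VField G} (a b : ℝ), SmoothFieldOn X Set.univ → SmoothFieldOn Y Set.univ →
      SmoothFieldOn (a • X + b • Y) Set.univ := fun a b hX hY =>
    ContMDiffOn.add_section (ContMDiffOn.const_smul_section hX) (ContMDiffOn.const_smul_section hY)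
  have hbr : ⁅g 1, g 2⁆ = σ • ⁅f 1, f 2⁆ := by
    rw [h1, h2, ← hdet]
    simp only [add_lie, lie_add, smul_lie, lie_smul, lie_self, smul_zero, zero_add, add_zero]
    rw [← lie_skew (f 2) (f 1)]
    module
  obtain ⟨s0, s1, s2, ho, α, hα, hker, h12, hα0, hReeb⟩ := h
  have hα1 : ∀ q, α q (f.field 1 q) = 0 := fun q => (hker q _).1 (ho q).2.1
  have hα2 : ∀ q, α q (f.field 2 q) = 0 := fun q => (hker q _).1 (ho q).2.2.1
  have hσ0 : σ ≠ 0 := by rintro rfl; norm_num at hσ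
  refine ⟨?_, ?_, ?_, fun q => ?_, fun q => σ • α q, ?_, ?_, ?_, ?_, ?_⟩
  · rw [hg0]; exact ContMDiffOn.const_smul_section s0
  · rw [hg1]; exact hsm a b s1 s2
  · rw [hg2]; exact hsm c d s1 s2
  · have hq1 : g.field 1 q = a • f.field 1 q + b • f.field 2 q := congrFun hg1 q
    have hq2 : g.field 2 q = c • f.field 1 q + d • f.field 2 q := congrFun hg2 q
    have m1 : g.field 1 q ∈ S.dist q := by
      rw [hq1]
      exact add_mem (Submodule.smul_mem _ _ (ho q).2.1) (Submodule.smul_mem _ _ (ho q).2.2.1)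
    have m2 : g.field 2 q ∈ S.dist q := by
      rw [hq2]
      exact add_mem (Submodule.smul_mem _ _ (ho q).2.1) (Submodule.smul_mem _ _ (ho q).2.2.1)
    refine ⟨?_, m1, m2, ?_, ?_, ?_⟩
    · apply le_antisymm
      · rw [(ho q).1, Submodule.span_le, Set.pair_subset_iff]
        have t1 : σ * d * a - σ * b * c = 1 := by linear_combination σ * hdet + hσ
        have e1 : f.field 1 q = (σ * d) • g.field 1 q + (-(σ * b)) • g.field 2 q := by
          rw [hq1, hq2]
          trans (σ * d * a - σ * b * c) • f.field 1 q
          · rw [t1, one_smul]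
          · module
        have e2 : f.field 2 q = (-(σ * c)) • g.field 1 q + (σ * a) • g.field 2 q := by
          rw [hq1, hq2]
          trans (σ * d * a - σ * b * c) • f.field 2 q
          · rw [t1, one_smul]
          · module
        exact ⟨Submodule.mem_span_pair.2 ⟨_, _, e1.symm⟩, Submodule.mem_span_pair.2 ⟨_, _, e2.symm⟩⟩
      · rw [Submodule.span_le, Set.pair_subset_iff]
        exact ⟨m1, m2⟩
    · rw [(ho q).metric_eq hq1 hq1, hab]
    · rw [(ho q).metric_eq hq2 hq2, hcd]
    · rw [(ho q).metric_eq hq1 hq2, hac]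
  · intro V hV hVU X hX
    exact ContMDiffOn.mul contMDiffOn_const (hα V hV hVU X hX)
  · intro q v
    rw [hker q v]
    change _ ↔ σ * α q v = 0
    simp [hσ0]
  · intro q
    have hα1' : ∀ q, α q ((mulInvariantVectorField (g 1) : VField G) q) = 0 := fun q => by
      change α q (g.field 1 q) = 0
      rw [hg1]
      change α q (a • f.field 1 q + b • f.field 2 q) = 0
      rw [map_add, map_smul, map_smul, hα1, hα2]
      simp
    have hα2' : ∀ q, α q ((mulInvariantVectorField (g 2) : VField G) q) = 0 := fun q => by
      change α q (g.field 2 q) = 0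
      rw [hg2]
      change α q (c • f.field 1 q + d • f.field 2 q) = 0
      rw [map_add, map_smul, map_smul, hα1, hα2]
      simp
    have hs1 : ∀ q, (σ • α q) ((mulInvariantVectorField (g 1) : VField G) q) = 0 := fun q => by
      change σ * α q _ = 0
      rw [hα1', mul_zero]
    have hs2 : ∀ q, (σ • α q) ((mulInvariantVectorField (g 2) : VField G) q) = 0 := fun q => by
      change σ * α q _ = 0
      rw [hα2', mul_zero]
    have e := h12 q
    rw [LieFrame.field, LieFrame.field, extDerivForm_mulInvariantVectorField hα1 hα2] at e
    rw [LieFrame.field, LieFrame.field, extDerivForm_mulInvariantVectorField hs1 hs2, hbr,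
      mulInvariantVectorField_smul]
    change -(σ * α q (σ • (mulInvariantVectorField ⁅f 1, f 2⁆ : VField G) q)) = 1
    rw [map_smul, smul_eq_mul]
    linear_combination σ * σ * e + hσ
  · intro q
    rw [hg0]
    change σ * α q (σ • f.field 0 q) = 1
    rw [map_smul, hα0, smul_eq_mul, mul_one, hσ]
  · intro X hX q
    have e := hReeb X hX q
    have hs : SmoothFunOn (fun p => α p (X p)) Set.univ := hα _ isOpen_univ subset_rfl X hX
    have hc : MDifferentiableAt (𝓡 3) 𝓘(ℝ, ℝ) (fun _ : G => σ) q := mdifferentiableAt_const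
    rw [hg0]
    rw [extDerivForm] at e ⊢
    have e1 : (fun p => (σ • α p) ((σ • f.field 0) p)) = fun _ => (1 : ℝ) := by
      funext p
      change σ * α p (σ • f.field 0 p) = 1
      rw [map_smul, hα0, smul_eq_mul, mul_one, hσ]
    have e2 : fieldDeriv (σ • f.field 0) (fun p => (σ • α p) (X p)) q =
        σ * (σ * fieldDeriv (f.field 0) (fun p => α p (X p)) q) := by
      have := fieldDeriv_mul (X := f.field 0) hc (hs.mdifferentiableAt isOpen_univ (Set.mem_univ q))
      rw [fieldDeriv_const, mul_zero, add_zero] at this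
      rw [← this]
      exact map_smul (mfderiv (𝓡 3) 𝓘(ℝ, ℝ) (fun p => σ * α p (X p)) q) σ (f.field 0 q)
    rw [e1, e2, fieldDeriv_const, mlieBracket_const_smul_left
      ((s0.contMDiffAt Filter.univ_mem).mdifferentiableAt (by simp))]
    change _ - _ - σ * α q (σ • _) = 0
    simp only [hα0, fieldDeriv_const] at e
    rw [map_smul, smul_eq_mul]
    linear_combination σ * σ * e

end SubRiemannian

end Group

/-! ### The curvature condition for conformally flat structures -/

section Necessity

variable {M : Type*} [TopologicalSpace M] [ChartedSpace E3 M] [IsManifold (𝓡 3) ∞ M]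
  {S : SubRiemannian M} {X : Fin 3 → VField M} {U : Set M} {β p : ℝ} {φ : M → ℝ}

/-- The three coordinates of a local isometry to the Heisenberg group solve the overdetermined
system of `IsStructureFrame.obstruction`. -/
theorem SubRiemannian.IsAdmissible.obstruction (hadm : S.IsAdmissible U φ)
    (h : IsStructureFrame X U β p)
    (horth : ∀ q ∈ U, IsOrthonormalPairAt S.dist S.metric (X 1) (X 2) q)
    (hφ : SmoothFunOn φ U) (hne : U.Nonempty) : p * (9 * p - 2 * β ^ 2) = 0 := by
  obtain ⟨q₀, hq₀⟩ := hne
  obtain ⟨Φ, hqΦ, hΦU, hΦ, -, hiso⟩ := hadm q₀ hq₀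
  have hmd : ∀ q ∈ Φ.source, MDifferentiableAt (𝓡 3) (𝓡 3) Φ q := fun q hq =>
    (hΦ.contMDiffAt (Φ.open_source.mem_nhds hq)).mdifferentiableAt (by simp)
  have hmem : ∀ q ∈ Φ.source, ∀ i ≠ 0, X i q ∈ S.dist q := by
    intro q hq i hi
    have ho := horth q (hΦU hq)
    fin_cases i
    exacts [absurd rfl hi, ho.2.1, ho.2.2.1]
  have hmem' : ∀ q (hq : q ∈ Φ.source) (i : Fin 3), i ≠ 0 →
      mfderiv (𝓡 3) (𝓡 3) Φ q (X i q) ∈ SubRiemannian.heisenberg.dist (Φ q) := by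
    intro q hq i hi
    rw [(hiso q hq).1]
    exact Submodule.mem_map_of_mem (hmem q hq i hi)
  have hmet : ∀ q ∈ Φ.source, ∀ i ≠ 0, ∀ j ≠ 0, ∀ r : ℝ,
      (∀ (hi : X i q ∈ S.dist q) (hj : X j q ∈ S.dist q), S.metric q ⟨_, hi⟩ ⟨_, hj⟩ = r) →
      fieldDeriv (X i) (fun p => Φ p 0) q * fieldDeriv (X j) (fun p => Φ p 0) q +
        fieldDeriv (X i) (fun p => Φ p 1) q * fieldDeriv (X j) (fun p => Φ p 1) q =
      Real.exp (2 * φ q) * r := by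
    intro q hq i hi j hj r hr
    have e := (hiso q hq).2 ⟨_, hmem q hq i hi⟩ ⟨_, hmem q hq j hj⟩ ⟨_, hmem' q hq i hi⟩
      ⟨_, hmem' q hq j hj⟩ rfl rfl
    rw [hr] at e
    rw [← e, fieldDeriv_coord (hmd q hq), fieldDeriv_coord (hmd q hq),
      fieldDeriv_coord (hmd q hq), fieldDeriv_coord (hmd q hq)]
    rfl
  refine (h.mono hΦU).obstruction Φ.open_source ⟨q₀, hqΦ⟩ (SmoothFunOn.coord hΦ 0)
    (SmoothFunOn.coord hΦ 1) (SmoothFunOn.coord hΦ 2) (ContMDiffOn.mono hφ hΦU) ?_ ?_ ?_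
  · intro q hq i hi
    obtain ⟨a, b, hab⟩ := SubRiemannian.heis_coords (hmem' q hq i hi)
    rw [fieldDeriv_coord (hmd q hq), fieldDeriv_coord (hmd q hq), fieldDeriv_coord (hmd q hq)]
    rw [hab]
    simp
    ring
  · intro q hq i hi
    refine (hmet q hq i hi i hi 1 fun h1 _ => ?_).trans (mul_one _)
    obtain ⟨-, _, _, h11, h22, -⟩ := horth q (hΦU hq)
    fin_cases i
    exacts [absurd rfl hi, h11, h22]
  · intro q hq
    refine (hmet q hq 1 (by decide) 2 (by decide) 0 fun _ _ => ?_).trans (mul_zero _)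
    obtain ⟨-, _, _, -, -, h12⟩ := horth q (hΦU hq)
    exact h12

end Necessity

/-! ### Canonical frames -/

section Canonical

variable {G : Type*} [TopologicalSpace G] [ChartedSpace E3 G] [Group G] [LieGroup (𝓡 3) ∞ G]

namespace LieFrame

variable {f g : LieFrame G}

theorem repr_smul_add_smul {i j : Fin 3} (hij : i ≠ j) (a b : ℝ) :
    f.repr (a • f i + b • f j) i = a ∧ f.repr (a • f i + b • f j) j = b := by
  constructor
  · simp [hij]
  · simp [hij.symm]

theorem chi_ne_zero_of_canonical (h1 : f.c10 1 = 0) (hs : f.c10 2 + f.c20 1 ≠ 0) : f.chi ≠ 0 := by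
  rw [chi, h1, Real.sqrt_ne_zero']
  have := pow_pos (abs_pos.2 hs) 2
  rw [sq_abs] at this
  linarith

theorem add_ne_zero_of_chi_ne_zero (h1 : f.c10 1 = 0) (h : f.chi ≠ 0) :
    f.c10 2 + f.c20 1 ≠ 0 := by
  intro h0
  apply h
  rw [chi, h1, h0]
  simp

end LieFrame

namespace SubRiemannian

variable {S : SubRiemannian G} {f g : LieFrame G}

theorem IsAdaptedLieFrame.bracket (h : S.IsAdaptedLieFrame f) :
    ⁅f 2, f 1⁆ = f 0 + f.c12 1 • f 1 + f.c12 2 • f 2 ∧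
      ⁅f 1, f 0⁆ = f.c10 1 • f 1 + f.c10 2 • f 2 ∧
      ⁅f 2, f 0⁆ = f.c20 1 • f 1 + f.c20 2 • f 2 := by
  obtain ⟨h1, h2, h3⟩ := h.repr_bracket
  refine ⟨?_, ?_, ?_⟩
  · conv_lhs => rw [← f.sum_repr ⁅f 2, f 1⁆, Fin.sum_univ_three, h1, one_smul]
    rfl
  · conv_lhs => rw [← f.sum_repr ⁅f 1, f 0⁆, Fin.sum_univ_three, h2, zero_smul, zero_add]
    rfl
  · conv_lhs => rw [← f.sum_repr ⁅f 2, f 0⁆, Fin.sum_univ_three, h3, zero_smul, zero_add]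
    rfl

theorem IsAdaptedLieFrame.isCanonicalFrame (h : S.IsAdaptedLieFrame f) (h1 : f.c10 1 = 0)
    (h2 : f.c20 2 = 0) (hs : f.c10 2 + f.c20 1 ≠ 0) : S.IsCanonicalFrame f := by
  obtain ⟨e1, e2, e3⟩ := h.bracket
  refine ⟨h, LieFrame.chi_ne_zero_of_canonical h1 hs, e1, ?_, ?_⟩
  · rw [e2, h1, zero_smul, zero_add]
  · rw [e3, h2, zero_smul, add_zero]

/-- By the Jacobi identity `ad f₀` is trace-free on the plane; rotating `f₁, f₂` by half the argument
of `(c₁₀² + c₂₀¹) / 2 - i c₁₀¹` makes its diagonal vanish. -/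
theorem HasNonzeroChi.exists_isCanonicalFrame (hchi : S.HasNonzeroChi) :
    ∃ f : LieFrame G, S.IsCanonicalFrame f := by
  obtain ⟨f, hf, hchi⟩ := hchi
  obtain ⟨e21, e10, e20⟩ := hf.bracket
  have hD := adapted_jacobi f e21 e10 e20
  set A := f.c10 1 with hA
  set B := f.c10 2
  set C := f.c20 1
  have hne : A * A + (B + C) / 2 * ((B + C) / 2) ≠ 0 := by
    intro h0
    apply hchi
    rw [LieFrame.chi, hD, Real.sqrt_eq_zero']
    refine le_of_eq ?_
    linear_combination h0
  obtain ⟨c, s, hcs, hA0, hK⟩ := exists_rotation hne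
  have hac : c * -s + s * c = 0 := by ring
  have hss : -s * -s + c * c = 1 := by linear_combination hcs
  obtain ⟨g, g0, g1, g2⟩ := exists_basis_of_orthogonal f (σ := 1) (one_mul 1) hcs hss hac
  have hg := hf.of_orthogonal (σ := 1) (one_mul 1) hcs hss hac (by linear_combination hcs) g0 g1 g2
  rw [one_smul] at g0
  have f1 : f 1 = c • g 1 + (-s) • g 2 := by
    rw [g1, g2]
    trans (c * c + s * s) • f 1
    · rw [hcs, one_smul]
    · module
  have f2 : f 2 = s • g 1 + c • g 2 := by
    rw [g1, g2]
    trans (c * c + s * s) • f 2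
    · rw [hcs, one_smul]
    · module
  have b1 : ⁅g 1, g 0⁆ = (c * (A * c + B * s) + s * (C * c - A * s)) • g 1 +
      (c * (B * c - A * s) + s * (-A * c - C * s)) • g 2 := by
    rw [g0, g1, add_lie, smul_lie, smul_lie, e10, e20, hD, ← g1, f1, f2]
    module
  have b2 : ⁅g 2, g 0⁆ = (-s * (A * c + B * s) + c * (C * c - A * s)) • g 1 +
      (-s * (B * c - A * s) + c * (-A * c - C * s)) • g 2 := by
    rw [g0, g2, add_lie, smul_lie, smul_lie, e10, e20, hD, ← g2, f1, f2]
    module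
  have r1 := LieFrame.repr_smul_add_smul (f := g) (i := 1) (j := 2) (by decide)
    (c * (A * c + B * s) + s * (C * c - A * s)) (c * (B * c - A * s) + s * (-A * c - C * s))
  have r2 := LieFrame.repr_smul_add_smul (f := g) (i := 1) (j := 2) (by decide)
    (-s * (A * c + B * s) + c * (C * c - A * s)) (-s * (B * c - A * s) + c * (-A * c - C * s))
  rw [← b1] at r1
  rw [← b2] at r2
  refine ⟨g, hg.isCanonicalFrame (r1.1.trans ?_) (r2.2.trans ?_) ?_⟩
  · linear_combination hA0
  · linear_combination -hA0
  · intro h0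
    rw [LieFrame.c10, LieFrame.c20, r1.2, r2.1] at h0
    apply hK
    linear_combination h0 / 2

end SubRiemannian

end Canonical

/-! ### Conformal flatness in canonical frames -/

section Flatness

variable {G : Type*} [TopologicalSpace G] [ChartedSpace E3 G] [Group G] [LieGroup (𝓡 3) ∞ G]

namespace SubRiemannian

variable {S : SubRiemannian G} {f : LieFrame G} {U : Set G} {φ : G → ℝ}

/-- A canonical frame is of one of two shapes, exchanged by swapping `f₁` and `f₂`. -/
theorem IsCanonicalFrame.coefficients (h : S.IsCanonicalFrame f)
    (hnonuni : ¬ IsUnimodularLieGroup G) :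
    (f.c12 1 = 0 ∧ f.c20 1 = 0 ∧ f.c10 2 ≠ 0) ∨ (f.c12 2 = 0 ∧ f.c10 2 = 0 ∧ f.c20 1 ≠ 0) := by
  obtain ⟨-, hchi, h21, h10, h20⟩ := h
  have h1 : f.c10 1 = 0 := by rw [LieFrame.c10, h10]; simp
  have hs := LieFrame.add_ne_zero_of_chi_ne_zero h1 hchi
  obtain ⟨hp, hq⟩ := canonical_jacobi f h21 h10 h20
  have hne : f.c12 1 ≠ 0 ∨ f.c12 2 ≠ 0 := by
    -- otherwise `[f₂, f₁] = f₀` and the algebra is unimodular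
    by_contra! h0
    rw [h0.1, h0.2, zero_smul, zero_smul, add_zero, add_zero] at h21
    exact hnonuni fun m => trace_ad_eq_zero_of_canonical f h21 h10 h20 m
  grind

/-- Swapping `f₁` and `f₂` reverses the orientation of the plane, hence changes the sign of the
contact form and of the Reeb field `f₀`; it exchanges the two shapes of a canonical frame. -/
theorem IsCanonicalFrame.exists_swap (h : S.IsCanonicalFrame f) :
    ∃ g : LieFrame G, S.IsCanonicalFrame g ∧ g.field 1 = f.field 2 ∧ g.field 2 = f.field 1 ∧
      g.c12 1 = -f.c12 2 ∧ g.c12 2 = -f.c12 1 ∧ g.c10 2 = -f.c20 1 ∧ g.c20 1 = -f.c10 2 ∧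
      (g.StructI ↔ f.StructII) := by
  obtain ⟨hf, hchi, h21, h10, h20⟩ := h
  have h1 : f.c10 1 = 0 := by rw [LieFrame.c10, h10]; simp
  have hs := LieFrame.add_ne_zero_of_chi_ne_zero h1 hchi
  obtain ⟨g, g0, g1, g2⟩ : ∃ g : LieFrame G, g 0 = (-1 : ℝ) • f 0 ∧
      g 1 = (0 : ℝ) • f 1 + (1 : ℝ) • f 2 ∧ g 2 = (1 : ℝ) • f 1 + (0 : ℝ) • f 2 :=
    exists_basis_of_orthogonal f (by norm_num) (by norm_num) (by norm_num) (by norm_num)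
  have hg := hf.of_orthogonal (by norm_num) (by norm_num) (by norm_num) (by norm_num)
    (by norm_num) g0 g1 g2
  simp only [neg_smul, one_smul, zero_smul, zero_add, add_zero] at g0 g1 g2
  have b21 : ⁅g 2, g 1⁆ = -⁅f 2, f 1⁆ := by rw [g1, g2, lie_skew]
  have b10 : ⁅g 1, g 0⁆ = -⁅f 2, f 0⁆ := by rw [g0, g1, lie_neg]
  have b20 : ⁅g 2, g 0⁆ = -⁅f 1, f 0⁆ := by rw [g0, g2, lie_neg]
  have e21 : ⁅g 2, g 1⁆ = g 0 + (-f.c12 2) • g 1 + (-f.c12 1) • g 2 := by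
    rw [b21, h21, g0, g1, g2]; module
  have e10 : ⁅g 1, g 0⁆ = (-f.c20 1) • g 2 := by rw [b10, h20, g2, neg_smul]
  have e20 : ⁅g 2, g 0⁆ = (-f.c10 2) • g 1 := by rw [b20, h10, g1, neg_smul]
  have c1 : g.c12 1 = -f.c12 2 := by rw [LieFrame.c12, e21]; simp
  have c2 : g.c12 2 = -f.c12 1 := by rw [LieFrame.c12, e21]; simp
  have c3 : g.c10 2 = -f.c20 1 := by rw [LieFrame.c10, e10]; simp
  have c4 : g.c20 1 = -f.c10 2 := by rw [LieFrame.c20, e20]; simp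
  refine ⟨g, hg.isCanonicalFrame ?_ ?_ ?_, ?_, ?_, c1, c2, c3, c4, ?_⟩
  · rw [LieFrame.c10, e10]; simp
  · rw [LieFrame.c20, e20]; simp
  · rw [c3, c4]
    intro h0
    exact hs (by linear_combination -h0)
  · rw [LieFrame.field, LieFrame.field, g1]
  · rw [LieFrame.field, LieFrame.field, g2]
  · rw [LieFrame.StructI, LieFrame.StructII, b21, b10, b20, c2, g0, g2, neg_sq, neg_smul, neg_smul,
      ← neg_add, neg_inj, neg_eq_zero, neg_eq_iff_eq_neg]

theorem IsAdaptedLieFrame.isStructureFrame_of_structI (h : S.IsAdaptedLieFrame f)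
    (hI : f.StructI) : IsStructureFrame f.field Set.univ (f.c12 2) (2 / 9 * f.c12 2 ^ 2) :=
  f.isStructureFrame h.smooth hI.1 hI.2.1 hI.2.2

theorem IsAdaptedLieFrame.exists_conformal_factor (h : S.IsAdaptedLieFrame f) (hI : f.StructI)
    (q : G) : ∃ U : Set G, IsOpen U ∧ q ∈ U ∧ ∃ φ : G → ℝ, SmoothFunOn φ U ∧
      ∀ p ∈ U, fieldDeriv (f.field 1) φ p = -f.c12 2 / 3 ∧ fieldDeriv (f.field 2) φ p = 0 := by
  obtain ⟨U, -, hU, hq, h⟩ :=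
    (h.isStructureFrame_of_structI hI).exists_conformal_factor isOpen_univ (Set.mem_univ q)
  exact ⟨U, hU, hq, h⟩

theorem IsAdaptedLieFrame.isAdmissible (h : S.IsAdaptedLieFrame f) (hI : f.StructI)
    (hU : IsOpen U) (hφ : SmoothFunOn φ U)
    (hder : ∀ p ∈ U, fieldDeriv (f.field 1) φ p = -f.c12 2 / 3 ∧ fieldDeriv (f.field 2) φ p = 0) :
    S.IsAdmissible U φ :=
  S.isAdmissible_of_structureFrame ((h.isStructureFrame_of_structI hI).mono (Set.subset_univ U)) hU
    (fun q _ => h.2.2.2.1 q) hφ (fun p hp => (hder p hp).1) fun p hp => (hder p hp).2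

theorem IsAdaptedLieFrame.isLocallyConformallyFlat (h : S.IsAdaptedLieFrame f) (hI : f.StructI) :
    S.IsLocallyConformallyFlat := by
  intro q
  obtain ⟨U, hU, hq, φ, hφ, hder⟩ := h.exists_conformal_factor hI q
  exact ⟨U, hU, hq, φ, hφ, h.isAdmissible hI hU hφ hder⟩

/-- In a conformally flat structure `p = c₁₀²` satisfies `p (9 p - 2 β²) = 0` with `β = c₁₂²`, and
`p ≠ 0` because `χ ≠ 0`. -/
theorem IsCanonicalFrame.structI (h : S.IsCanonicalFrame f) (h12 : f.c12 1 = 0)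
    (h20 : f.c20 1 = 0) (h10 : f.c10 2 ≠ 0) (hflat : S.IsLocallyConformallyFlat) : f.StructI := by
  obtain ⟨hf, -, e21, e10, e20⟩ := h
  rw [h12, zero_smul, add_zero] at e21
  rw [h20, zero_smul] at e20
  obtain ⟨U, hU, hq, φ, hφ, hadm⟩ := hflat 1
  have hs := (f.isStructureFrame hf.smooth e21 e10 e20).mono (Set.subset_univ U)
  have hp := (mul_eq_zero.1 (hadm.obstruction hs (fun q _ => hf.2.2.2.1 q) hφ
    ⟨1, hq⟩)).resolve_left h10
  refine ⟨e21, ?_, e20⟩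
  rw [e10]
  congr 1
  linarith

end SubRiemannian

end Flatness

end

theorem theorem5p5 {G : Type*} [TopologicalSpace G] [ChartedSpace E3 G] [Group G]
    [LieGroup (𝓡 3) ∞ G] [ConnectedSpace G]
    (S : SubRiemannian G) (hinv : S.IsLeftInvariant) (hcontact : S.IsContact)
    (hnonuni : ¬ IsUnimodularLieGroup G) (hchi : S.HasNonzeroChi) :
    (∃ f : LieFrame G, S.IsCanonicalFrame f) ∧
    ∀ f : LieFrame G, S.IsCanonicalFrame f →
      (S.IsLocallyConformallyFlat ↔ f.StructI ∨ f.StructII) ∧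
      (f.StructI →
        (∀ q : G, ∃ U : Set G, IsOpen U ∧ q ∈ U ∧ ∃ φ : G → ℝ, SmoothFunOn φ U ∧
          ∀ p ∈ U, fieldDeriv (f.field 1) φ p = -f.c12 2 / 3 ∧
            fieldDeriv (f.field 2) φ p = 0) ∧
        ∀ (U : Set G) (φ : G → ℝ), IsOpen U → SmoothFunOn φ U →
          (∀ p ∈ U, fieldDeriv (f.field 1) φ p = -f.c12 2 / 3 ∧
            fieldDeriv (f.field 2) φ p = 0) → S.IsAdmissible U φ) ∧
      (f.StructII →
        (∀ q : G, ∃ U : Set G, IsOpen U ∧ q ∈ U ∧ ∃ φ : G → ℝ, SmoothFunOn φ U ∧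
          ∀ p ∈ U, fieldDeriv (f.field 2) φ p = f.c12 1 / 3 ∧
            fieldDeriv (f.field 1) φ p = 0) ∧
        ∀ (U : Set G) (φ : G → ℝ), IsOpen U → SmoothFunOn φ U →
          (∀ p ∈ U, fieldDeriv (f.field 2) φ p = f.c12 1 / 3 ∧
            fieldDeriv (f.field 1) φ p = 0) → S.IsAdmissible U φ) := by
  refine ⟨hchi.exists_isCanonicalFrame, fun f hf => ?_⟩
  obtain ⟨g, hg, g1, g2, c1, c2, c3, c4, hiff⟩ := hf.exists_swap
  have hc : -g.c12 2 / 3 = f.c12 1 / 3 := by rw [c2, neg_neg]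
  refine ⟨⟨fun hflat => ?_, fun h => ?_⟩, fun hI => ⟨hf.1.exists_conformal_factor hI, fun U φ =>
    hf.1.isAdmissible hI⟩, fun hII => ?_⟩
  · rcases hf.coefficients hnonuni with ⟨h12, h20, h10⟩ | ⟨h12, h10, h20⟩
    · exact Or.inl (hf.structI h12 h20 h10 hflat)
    · refine Or.inr (hiff.1 (hg.structI ?_ ?_ ?_ hflat))
      · rw [c1, h12, neg_zero]
      · rw [c4, h10, neg_zero]
      · rw [c3]; exact neg_ne_zero.2 h20
  · rcases h with hI | hII
    · exact hf.1.isLocallyConformallyFlat hI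
    · exact hg.1.isLocallyConformallyFlat (hiff.2 hII)
  · rw [← g1, ← g2, ← hc]
    exact ⟨hg.1.exists_conformal_factor (hiff.2 hII), fun U φ => hg.1.isAdmissible (hiff.2 hII)⟩
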